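/- Let $n\ge 2$ be an integer and let $u,v,x$ be real numbers with $u<v$, $v\neq -u$ and $x\neq 0$. Write $2n\times 2n$ matrices in $n\times n$ blocks. Let $\mathrm{SB}(2n)<\mathrm{SL}(2n,\mathbb C)$ be the subgroup of upper triangular matrices with positive diagonal entries. Every $K\in \mathrm{SL}(2n,\mathbb C)$ has unique Iwasawa decompositions $K=g_Lb_R^{-1}=b_Lg_R^{-1}$ with $g_L,g_R\in \mathrm{SU}(2n)$ and $b_L,b_R\in \mathrm{SB}(2n)$. Let $G_+=\mathrm S(\mathrm U(n)\times \mathrm U(n))$ be the block-diagonal subgroup of $\mathrm{SU}(2n)$, let $G_+^*$ be the block-diagonal subgroup of $\mathrm{SB}(2n)$, and let $\pi:\mathrm{SB}(2n)\to G_+^*$ be the map that replaces the upper right block by $0$. Define $$\Phi_+:\mathrm{SL}(2n,\mathbb C)\to G_+^*\times G_+^*,\qquad \Phi_+(K)=(\pi(b_L),\pi(b_R)).$$ Let $\nu(x)$ be the upper triangular $n\times n$ matrix with $\nu(x)_{jj}=1$ and $\nu(x)_{jk}=(1-e^{-x})e^{(k-j)x/2}$ for $j<k$, and put $$\mu=(\mu_L,\mu_R),\qquad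 \mu_L=\begin{bmatrix}e^u\nu(x)&0\\0&e^{-u}\mathbf 1_n\end{bmatrix},\qquad \mu_R=\begin{bmatrix}e^v\mathbf 1_n&0\\0&e^{-v}\mathbf 1_n\end{bmatrix}.$$ Let $G_\mu$ be the group of all $(\eta_L,\eta_R)\in G_+\times G_+$ with $\eta_L\mu_L\mu_L^\dagger\eta_L^{-1}=\mu_L\mu_L^\dagger$ and $\eta_R\mu_R\mu_R^\dagger\eta_R^{-1}=\mu_R\mu_R^\dagger$; equivalently, $\eta_R\in G_+$ is arbitrary and the first diagonal block of $\eta_L\in G_+$ commutes with $\nu(x)\nu(x)^\dagger$. The group $G_\mu$ acts on the constraint surface $\Phi_+^{-1}(\mu)=\{K\in \mathrm{SL}(2n,\mathbb C)\mid \Phi_+(K)=\mu\}$ by $(\eta_L,\eta_R)\cdot K=\eta_LK\eta_R^{-1}$. The pairs $(\eta,\eta)$ with $\eta=\mathrm{diag}(z\mathbf 1_n,z\mathbf 1_n)$, $z\in\mathbb C$, $z^{2n}=1$, form a finite central subgroup of $G_\mu$ that acts trivially. Let the effective gauge group $\bar G_\mu$ be the quotient of $G_\mu$ by this subgroup, with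 its induced action on $\Phi_+^{-1}(\mu)$. Then $\bar G_\mu$ acts freely on $\Phi_+^{-1}(\mu)$: if $g\in\bar G_\mu$ and $K\in\Phi_+^{-1}(\mu)$ satisfy $g\cdot K=K$, then $g$ is the identity element. -/

import Mathlib

open scoped Matrix

namespace HeisenbergDouble

/-- Index set of `2n × 2n` matrices written in `n × n` blocks. -/
abbrev Idx (n : ℕ) := Fin n ⊕ Fin n

/-- The group `SL(2n, ℂ)`. -/
abbrev SL (n : ℕ) := Matrix.SpecialLinearGroup (Idx n) ℂ

/-! ### Triangular matrices with positive diagonal -/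

/-- Upper triangular with strictly positive (real) diagonal entries, with respect to the order
pulled back along `e`. -/
def IsPosTriangular {ι α : Type*} [LT α] (e : ι → α) (b : Matrix ι ι ℂ) : Prop :=
  b.BlockTriangular e ∧ ∀ i, ∃ r : ℝ, 0 < r ∧ b i i = (r : ℂ)

section Triangular

variable {ι α : Type*} [Fintype ι] [DecidableEq ι] [LinearOrder α]

theorem blockTriangular_mul_diag {ι α : Type*} [Fintype ι] [LinearOrder α] {e : ι → α} (he : Function.Injective e) {a b : Matrix ι ι ℂ}
    (ha : a.BlockTriangular e) (hb : b.BlockTriangular e) (i : ι) :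
    (a * b) i i = a i i * b i i := by
  rw [Matrix.mul_apply]
  refine Finset.sum_eq_single i (fun j _ hj => ?_) (by simp)
  rcases lt_trichotomy (e i) (e j) with h | h | h
  · rw [hb h, mul_zero]
  · exact absurd (he h).symm hj
  · rw [ha h, zero_mul]

theorem IsPosTriangular.one {ι α : Type*} [DecidableEq ι] [LinearOrder α] (e : ι → α) : IsPosTriangular e (1 : Matrix ι ι ℂ) :=
  ⟨Matrix.blockTriangular_one, fun i => ⟨1, one_pos, by simp⟩⟩

theorem IsPosTriangular.mul {e : ι → α} (he : Function.Injective e) {a b : Matrix ι ι ℂ}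
    (ha : IsPosTriangular e a) (hb : IsPosTriangular e b) : IsPosTriangular e (a * b) := by
  refine ⟨ha.1.mul hb.1, fun i => ?_⟩
  obtain ⟨r, hr, h⟩ := ha.2 i
  obtain ⟨s, hs, h'⟩ := hb.2 i
  exact ⟨r * s, mul_pos hr hs, by rw [blockTriangular_mul_diag he ha.1 hb.1, h, h']; push_cast; rfl⟩

theorem IsPosTriangular.of_mul_eq_one {e : ι → α} (he : Function.Injective e)
    {a b : Matrix ι ι ℂ} (ha : IsPosTriangular e a) (hab : a * b = 1) : IsPosTriangular e b := by
  have : Invertible a := invertibleOfRightInverse a b hab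
  have hb : b = a⁻¹ := (Matrix.inv_eq_right_inv hab).symm
  have ht : b.BlockTriangular e := hb ▸ Matrix.blockTriangular_inv_of_blockTriangular ha.1
  refine ⟨ht, fun i => ?_⟩
  obtain ⟨r, hr, h⟩ := ha.2 i
  refine ⟨r⁻¹, inv_pos.2 hr, ?_⟩
  have h1 := blockTriangular_mul_diag he ha.1 ht i
  rw [hab, Matrix.one_apply_eq, h] at h1
  have : (r : ℂ) ≠ 0 := by exact_mod_cast hr.ne'
  push_cast
  field_simp
  rw [mul_comm]; exact h1.symm

/-- A unitary upper triangular matrix with positive diagonal is the identity. -/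
theorem IsPosTriangular.eq_one {e : ι → α} (he : Function.Injective e) {a : Matrix ι ι ℂ}
    (ha : IsPosTriangular e a) (hu : a * aᴴ = 1) : a = 1 := by
  have hb := ha.of_mul_eq_one he hu
  have hdiag : ∀ i, a i i = 1 := by
    intro i
    obtain ⟨r, hr, h⟩ := ha.2 i
    have h1 := blockTriangular_mul_diag he ha.1 hb.1 i
    rw [hu, Matrix.one_apply_eq, Matrix.conjTranspose_apply, h] at h1
    have h2 : r * r = 1 := by
      have : (star (r : ℂ)) = (r : ℂ) := Complex.conj_ofReal r
      rw [this] at h1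
      exact_mod_cast h1.symm
    have h3 : r = 1 := by nlinarith
    rw [h, h3]; simp
  ext i j
  rcases lt_trichotomy (e i) (e j) with h | h | h
  · have h1 := hb.1 h
    rw [Matrix.conjTranspose_apply, star_eq_zero] at h1
    rw [h1, Matrix.one_apply_ne]
    rintro rfl; exact lt_irrefl _ h
  · obtain rfl := he h
    rw [hdiag, Matrix.one_apply_eq]
  · rw [ha.1 h, Matrix.one_apply_ne]
    rintro rfl; exact lt_irrefl _ h

open scoped ComplexOrder in
/-- Cholesky factorization with an upper triangular factor on the left. -/
theorem exists_isPosTriangular_id [Fintype α] {S : Matrix α α ℂ} (hS : S.PosDef) :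
    ∃ b : Matrix α α ℂ, IsPosTriangular (id : α → α) b ∧ b * bᴴ = S := by
  let : LocallyFiniteOrderBot α :=
    LocallyFiniteOrderBot.ofIic α (fun a => Finset.univ.filter (· ≤ a)) (by simp)
  have hS' : S⁻¹.PosDef := hS.inv
  set N := LDL.lowerInv hS' with hN
  have hNdet : IsUnit N.det := (Matrix.isUnit_iff_isUnit_det _).1 (isUnit_of_invertible N)
  have hSdet : IsUnit S.det := (Matrix.isUnit_iff_isUnit_det _).1 hS.isUnit
  have hD : LDL.diag hS' = N * S⁻¹ * Nᴴ := LDL.diag_eq_lowerInv_conj hS'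
  have htri : ∀ {i j : α}, i < j → N i j = 0 := fun h => LDL.lowerInv_triangular hS' h
  have hUtri : Nᴴ.BlockTriangular (id : α → α) := by
    intro i j h
    have h0 : N j i = 0 := htri h
    rw [Matrix.conjTranspose_apply, h0, star_zero]
  have hDpos : (LDL.diag hS').PosDef := by
    rw [hD]
    exact hS'.mul_mul_conjTranspose_same
      (Matrix.vecMul_injective_iff_isUnit.2 (isUnit_of_invertible N))
  have hd : ∀ i, ∃ d : ℝ, 0 < d ∧ LDL.diagEntries hS' i = (d : ℂ) := by
    intro i
    have h := hDpos.diag_pos (i := i)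
    rw [LDL.diag, Matrix.diagonal_apply_eq] at h
    obtain ⟨h1, h2⟩ := Complex.pos_iff.1 h
    exact ⟨_, h1, Complex.ext (by simp) (by simp [← h2])⟩
  choose d hdpos hdeq using hd
  have hNii : ∀ i, N i i ≠ 0 := by
    intro i h0
    apply hNdet.ne_zero
    rw [Matrix.det_of_isLowerTriangular N (fun i j h => htri h)]
    exact Finset.prod_eq_zero (Finset.mem_univ i) h0
  let c : α → ℂ := fun i => N i i / ((‖N i i‖ * Real.sqrt (d i) : ℝ) : ℂ)
  have hcc : ∀ i, c i * star (c i) = ((d i)⁻¹ : ℂ) := by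
    intro i
    have h1 : (‖N i i‖ : ℂ) ≠ 0 := by simpa using hNii i
    have h2 : ((Real.sqrt (d i) : ℝ) : ℂ) ^ 2 = (d i : ℂ) := by
      rw [← Complex.ofReal_pow, Real.sq_sqrt (hdpos i).le]
    have h3 : ((Real.sqrt (d i) : ℝ) : ℂ) ≠ 0 := by
      exact_mod_cast (Real.sqrt_pos.2 (hdpos i)).ne'
    have h4 : N i i * star (N i i) = (‖N i i‖ : ℂ) ^ 2 := Complex.mul_conj' _
    simp only [c, star_div₀]
    have h5 : star (((‖N i i‖ * Real.sqrt (d i) : ℝ) : ℂ)) = ((‖N i i‖ * Real.sqrt (d i) : ℝ) : ℂ) :=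
      Complex.conj_ofReal _
    rw [h5, div_mul_div_comm, h4, ← h2]
    push_cast
    field_simp
  refine ⟨Nᴴ * Matrix.diagonal c, ⟨hUtri.mul (Matrix.blockTriangular_diagonal c), fun i => ?_⟩, ?_⟩
  · refine ⟨‖N i i‖ / Real.sqrt (d i), div_pos (norm_pos_iff.2 (hNii i))
      (Real.sqrt_pos.2 (hdpos i)), ?_⟩
    have h1 : (‖N i i‖ : ℂ) ≠ 0 := by simpa using hNii i
    have h3 : ((Real.sqrt (d i) : ℝ) : ℂ) ≠ 0 := by
      exact_mod_cast (Real.sqrt_pos.2 (hdpos i)).ne'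
    have h4 : star (N i i) * N i i = (‖N i i‖ : ℂ) ^ 2 := Complex.conj_mul' _
    rw [Matrix.mul_diagonal, Matrix.conjTranspose_apply]
    simp only [c]
    rw [← mul_div_assoc, h4]
    push_cast
    field_simp
  · have hdiag : Matrix.diagonal c * (Matrix.diagonal c)ᴴ = (LDL.diag hS')⁻¹ := by
      symm
      apply Matrix.inv_eq_right_inv
      rw [LDL.diag, Matrix.diagonal_conjTranspose, Matrix.diagonal_mul_diagonal,
        Matrix.diagonal_mul_diagonal, ← Matrix.diagonal_one]
      congr 1
      ext i
      have h6 : (d i : ℂ) ≠ 0 := by exact_mod_cast (hdpos i).ne'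
      rw [Pi.star_apply, hcc, hdeq, mul_inv_cancel₀ h6]
    have hNH : IsUnit Nᴴ.det := by rw [Matrix.det_conjTranspose]; exact hNdet.star
    rw [Matrix.conjTranspose_mul, Matrix.conjTranspose_conjTranspose, Matrix.mul_assoc,
      ← Matrix.mul_assoc (Matrix.diagonal c), hdiag, hD, Matrix.mul_inv_rev, Matrix.mul_inv_rev,
      Matrix.nonsing_inv_nonsing_inv _ hSdet, Matrix.mul_assoc, Matrix.mul_assoc,
      Matrix.nonsing_inv_mul _ hNdet, Matrix.mul_one, ← Matrix.mul_assoc,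
      Matrix.mul_nonsing_inv _ hNH, Matrix.one_mul]

open scoped ComplexOrder in
theorem exists_isPosTriangular {ι α : Type*} [Fintype ι] [LinearOrder α] (e : ι ≃ α) {S : Matrix ι ι ℂ} (hS : S.PosDef) :
    ∃ b : Matrix ι ι ℂ, IsPosTriangular e b ∧ b * bᴴ = S := by
  let : Fintype α := Fintype.ofEquiv ι e
  obtain ⟨b, ⟨h1, h2⟩, h3⟩ := exists_isPosTriangular_id (α := α)
    (S := S.submatrix e.symm e.symm) (hS.submatrix e.symm.injective)
  refine ⟨b.submatrix e e, ⟨fun i j h => h1 h, fun i => h2 (e i)⟩, ?_⟩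
  rw [Matrix.conjTranspose_submatrix, Matrix.submatrix_mul_equiv, h3, Matrix.submatrix_submatrix]
  simp

end Triangular

/-! ### The groups `SU(2n)`, `SB(2n)`, `G₊`, `G₊*` -/

/-- `SU(2n)` as a subgroup of `SL(2n, ℂ)`. -/
def SU (n : ℕ) : Subgroup (SL n) where
  carrier := {g | (g : Matrix (Idx n) (Idx n) ℂ) ∈ Matrix.unitaryGroup (Idx n) ℂ}
  mul_mem' {a b} ha hb := by
    simp only [Set.mem_ofPred_eq, Matrix.SpecialLinearGroup.coe_mul] at *
    exact mul_mem ha hb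
  one_mem' := by
    simp only [Set.mem_ofPred_eq, Matrix.SpecialLinearGroup.coe_one]
    exact one_mem _
  inv_mem' {a} ha := by
    have h1 : a.1 * (a⁻¹ : SL n).1 = 1 := by
      rw [← Matrix.SpecialLinearGroup.coe_mul, mul_inv_cancel, Matrix.SpecialLinearGroup.coe_one]
    have h3 : star a.1 * a.1 = 1 := Matrix.mem_unitaryGroup_iff'.1 ha
    have h2 : (a⁻¹ : SL n).1 = star a.1 := by
      rw [← Matrix.one_mul (a⁻¹ : SL n).1, ← h3, Matrix.mul_assoc, h1, Matrix.mul_one]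
    change (a⁻¹ : SL n).1 ∈ Matrix.unitaryGroup (Idx n) ℂ
    rw [h2]
    exact Unitary.star_mem ha

/-- `SB(2n)`: the subgroup of `SL(2n, ℂ)` of upper triangular matrices with positive diagonal
entries; in the lexicographic order on `Fin n ⊕ Fin n` the first block comes before the second. -/
def SB (n : ℕ) : Subgroup (SL n) where
  carrier := {b | IsPosTriangular (toLex : Idx n → Fin n ⊕ₗ Fin n) b.1}
  mul_mem' {a b} ha hb := by
    simp only [Set.mem_ofPred_eq, Matrix.SpecialLinearGroup.coe_mul] at *
    exact ha.mul toLex.injective hb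
  one_mem' := IsPosTriangular.one _
  inv_mem' {a} ha := by
    refine IsPosTriangular.of_mul_eq_one toLex.injective ha ?_
    rw [← Matrix.SpecialLinearGroup.coe_mul, mul_inv_cancel, Matrix.SpecialLinearGroup.coe_one]

/-- `G₊ = S(U(n) × U(n))`: the block-diagonal subgroup of `SU(2n)`. -/
def Gplus (n : ℕ) : Subgroup (SL n) where
  carrier := {g | g ∈ SU n ∧ g.1.toBlocks₁₂ = 0 ∧ g.1.toBlocks₂₁ = 0}
  mul_mem' := by
    rintro a b ⟨ha, ha1, ha2⟩ ⟨hb, hb1, hb2⟩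
    refine ⟨mul_mem ha hb, ?_, ?_⟩ <;>
    · rw [Matrix.SpecialLinearGroup.coe_mul, ← Matrix.fromBlocks_toBlocks a.1,
        ← Matrix.fromBlocks_toBlocks b.1, Matrix.fromBlocks_multiply, ha1, ha2, hb1, hb2]
      simp
  one_mem' := by
    refine ⟨one_mem _, ?_, ?_⟩ <;>
    · ext i j
      simp [Matrix.toBlocks₁₂, Matrix.toBlocks₂₁]
  inv_mem' := by
    rintro a ⟨ha, ha1, ha2⟩
    have h2 : ((a⁻¹ : SL n) : Matrix (Idx n) (Idx n) ℂ) = (a.1)ᴴ := by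
      have h3 : (a.1)ᴴ * a.1 = 1 := Matrix.mem_unitaryGroup_iff'.1 ha
      have h1 : a.1 * ((a⁻¹ : SL n) : Matrix (Idx n) (Idx n) ℂ) = 1 := by
        rw [← Matrix.SpecialLinearGroup.coe_mul, mul_inv_cancel, Matrix.SpecialLinearGroup.coe_one]
      rw [← Matrix.one_mul ((a⁻¹ : SL n) : Matrix (Idx n) (Idx n) ℂ), ← h3, Matrix.mul_assoc, h1,
        Matrix.mul_one]
    refine ⟨inv_mem ha, ?_, ?_⟩ <;>
    · rw [h2, ← Matrix.fromBlocks_toBlocks a.1, Matrix.fromBlocks_conjTranspose, ha1, ha2]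
      simp

/-- `G₊*`: the subgroup of block-diagonal elements of `SB(2n)`. -/
def GplusDual (n : ℕ) : Subgroup (SL n) where
  carrier := {b | b ∈ SB n ∧ b.1.toBlocks₁₂ = 0}
  mul_mem' := by
    rintro a b ⟨ha, ha1⟩ ⟨hb, hb1⟩
    refine ⟨mul_mem ha hb, ?_⟩
    rw [Matrix.SpecialLinearGroup.coe_mul, ← Matrix.fromBlocks_toBlocks a.1,
        ← Matrix.fromBlocks_toBlocks b.1, Matrix.fromBlocks_multiply, ha1, hb1]
    simp
  one_mem' := by
    refine ⟨one_mem _, ?_⟩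
    ext i j
    simp [Matrix.toBlocks₁₂, Matrix.toBlocks₂₁]
  inv_mem' := by
    rintro a ⟨ha, ha1⟩
    have hi : a⁻¹ ∈ SB n := inv_mem ha
    refine ⟨hi, ?_⟩
    have h1 : a.1 * ((a⁻¹ : SL n) : Matrix (Idx n) (Idx n) ℂ) = 1 := by
      rw [← Matrix.SpecialLinearGroup.coe_mul, mul_inv_cancel, Matrix.SpecialLinearGroup.coe_one]
    have h2 : ((a⁻¹ : SL n) : Matrix (Idx n) (Idx n) ℂ) * a.1 = 1 := by
      rw [← Matrix.SpecialLinearGroup.coe_mul, inv_mul_cancel, Matrix.SpecialLinearGroup.coe_one]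
    have ha2 : ∀ i j, a.1 (Sum.inr i) (Sum.inl j) = 0 := fun i j => ha.1 (Sum.Lex.inl_lt_inr _ _)
    have ha2' : a.1.toBlocks₂₁ = 0 := by ext i j; exact ha2 i j
    have h3 := congrArg Matrix.toBlocks₁₂ h1
    have h4 := congrArg Matrix.toBlocks₁₁ h2
    rw [← Matrix.fromBlocks_toBlocks a.1,
      ← Matrix.fromBlocks_toBlocks ((a⁻¹ : SL n) : Matrix (Idx n) (Idx n) ℂ),
      Matrix.fromBlocks_multiply, ha1, ha2', ← Matrix.fromBlocks_one] at h3 h4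
    simp only [Matrix.toBlocks_fromBlocks₁₁, Matrix.toBlocks_fromBlocks₁₂, Matrix.zero_mul,
      Matrix.mul_zero, add_zero] at h3 h4
    rw [← Matrix.one_mul (Matrix.toBlocks₁₂ _), ← h4, Matrix.mul_assoc, h3, Matrix.mul_zero]

theorem SU.mem_iff {n : ℕ} {g : SL n} : g ∈ SU n ↔ g.1 * (g.1)ᴴ = 1 :=
  Matrix.mem_unitaryGroup_iff

/-! ### Iwasawa decompositions -/

theorem coe_mul_coe_inv {n : ℕ} (g : SL n) : g.1 * (g⁻¹ : SL n).1 = 1 := by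
  rw [← Matrix.SpecialLinearGroup.coe_mul, mul_inv_cancel, Matrix.SpecialLinearGroup.coe_one]

theorem coe_inv_mul_coe {n : ℕ} (g : SL n) : (g⁻¹ : SL n).1 * g.1 = 1 := by
  rw [← Matrix.SpecialLinearGroup.coe_mul, inv_mul_cancel, Matrix.SpecialLinearGroup.coe_one]

open scoped ComplexOrder in
/-- Existence of the Iwasawa decomposition `K = b_L g_R⁻¹`. -/
theorem exists_left {n : ℕ} (K : SL n) : ∃ b : SB n, ∃ g : SU n, K = (b : SL n) * (g : SL n)⁻¹ := by
  have hK : (K.1 * (K.1)ᴴ).PosDef := by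
    refine Matrix.PosDef.mul_conjTranspose_self _ (Matrix.vecMul_injective_iff_isUnit.2 ?_)
    rw [Matrix.isUnit_iff_isUnit_det, K.2]
    exact isUnit_one
  obtain ⟨b, hb, hbb⟩ := exists_isPosTriangular (toLex : Idx n ≃ Fin n ⊕ₗ Fin n) hK
  have hdet : b.det = 1 := by
    have hdb : ∃ r : ℝ, 0 < r ∧ b.det = (r : ℂ) := by
      have h1 : b.det = ∏ i, b i i := by
        have h2 := Matrix.det_of_isUpperTriangular
          (M := b.submatrix (toLex : Idx n ≃ Fin n ⊕ₗ Fin n).symm toLex.symm)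
          (fun i j h => hb.1 h)
        rw [Matrix.det_submatrix_equiv_self] at h2
        rw [h2]
        exact Fintype.prod_equiv (toLex : Idx n ≃ Fin n ⊕ₗ Fin n).symm _ _ (fun i => rfl)
      choose r hr hr' using hb.2
      refine ⟨∏ i, r i, Finset.prod_pos fun i _ => hr i, ?_⟩
      rw [h1, Complex.ofReal_prod]
      exact Finset.prod_congr rfl fun i _ => hr' i
    obtain ⟨r, hr, h⟩ := hdb
    have h1 := congrArg Matrix.det hbb
    rw [Matrix.det_mul, Matrix.det_mul, Matrix.det_conjTranspose, Matrix.det_conjTranspose, K.2, h]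
      at h1
    have h2 : (r : ℂ) * (r : ℂ) = 1 := by
      have : (star (r : ℂ)) = (r : ℂ) := Complex.conj_ofReal r
      rw [this] at h1
      simpa using h1
    have h3 : r * r = 1 := by exact_mod_cast h2
    have h4 : r = 1 := by nlinarith
    rw [h, h4]; simp
  let B : SL n := ⟨b, hdet⟩
  have hg : K⁻¹ * B ∈ SU n := by
    rw [SU.mem_iff, Matrix.SpecialLinearGroup.coe_mul, Matrix.conjTranspose_mul, Matrix.mul_assoc,
      ← Matrix.mul_assoc B.1]
    change _ * (b * bᴴ * _) = _
    rw [hbb, Matrix.mul_assoc, ← Matrix.conjTranspose_mul, coe_inv_mul_coe,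
      Matrix.conjTranspose_one, Matrix.mul_one, coe_inv_mul_coe]
  exact ⟨⟨B, hb⟩, ⟨_, hg⟩, by simp⟩

/-- Uniqueness of the triangular factor in the Iwasawa decomposition. -/
theorem left_unique {n : ℕ} {b b' g g' : SL n} (hb : b ∈ SB n) (hb' : b' ∈ SB n)
    (hg : g ∈ SU n) (hg' : g' ∈ SU n) (h : b * g⁻¹ = b' * g'⁻¹) : b = b' := by
  have h1 : b'⁻¹ * b = g'⁻¹ * g := by
    rw [inv_mul_eq_iff_eq_mul, ← mul_assoc, ← h, mul_assoc, inv_mul_cancel, mul_one]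
  have h2 : b'⁻¹ * b ∈ SB n := mul_mem (inv_mem hb') hb
  have h3 : b'⁻¹ * b ∈ SU n := h1 ▸ mul_mem (inv_mem hg') hg
  have h4 : b'⁻¹ * b = 1 :=
    Subtype.ext (IsPosTriangular.eq_one toLex.injective h2 (SU.mem_iff.1 h3))
  exact (inv_mul_eq_one.1 h4).symm

/-- Existence of the Iwasawa decomposition `K = g_L b_R⁻¹`. -/
theorem exists_right {n : ℕ} (K : SL n) :
    ∃ b : SB n, ∃ g : SU n, K = (g : SL n) * (b : SL n)⁻¹ := by
  obtain ⟨b, g, h⟩ := exists_left K⁻¹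
  exact ⟨b, g, by rw [← inv_inv K, h]; simp⟩

/-- The factor `b_L ∈ SB(2n)` of `K = b_L g_R⁻¹`, with `g_R ∈ SU(2n)`. -/
noncomputable def bL {n : ℕ} (K : SL n) : SB n := (exists_left K).choose

/-- The factor `b_R ∈ SB(2n)` of `K = g_L b_R⁻¹`, with `g_L ∈ SU(2n)`. -/
noncomputable def bR {n : ℕ} (K : SL n) : SB n := (exists_right K).choose

theorem bL_eq_iff {n : ℕ} (K : SL n) (b : SB n) :
    bL K = b ↔ ∃ g : SU n, K = (b : SL n) * (g : SL n)⁻¹ := by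
  obtain ⟨g, hg⟩ := (exists_left K).choose_spec
  constructor
  · rintro rfl; exact ⟨g, hg⟩
  · rintro ⟨g', hg'⟩
    exact Subtype.ext (left_unique (Subtype.prop _) b.2 g.2 g'.2 (hg.symm.trans hg'))

theorem bR_eq_iff {n : ℕ} (K : SL n) (b : SB n) :
    bR K = b ↔ ∃ g : SU n, K = (g : SL n) * (b : SL n)⁻¹ := by
  obtain ⟨g, hg⟩ := (exists_right K).choose_spec
  constructor
  · rintro rfl; exact ⟨g, hg⟩
  · rintro ⟨g', hg'⟩
    have h := congrArg (·⁻¹) (hg.symm.trans hg')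
    simp only [mul_inv_rev, inv_inv] at h
    exact Subtype.ext (left_unique (Subtype.prop _) b.2 g.2 g'.2 h)

/-! ### The momentum map -/

theorem SB.toBlocks₂₁ {n : ℕ} {b : SL n} (hb : b ∈ SB n) : b.1.toBlocks₂₁ = 0 := by
  ext i j; exact hb.1 (Sum.Lex.inl_lt_inr _ _)

theorem isPosTriangular_fromBlocks {n : ℕ} {a d : Matrix (Fin n) (Fin n) ℂ}
    (ha : IsPosTriangular (id : Fin n → Fin n) a) (hd : IsPosTriangular (id : Fin n → Fin n) d) :
    IsPosTriangular (toLex : Idx n → Fin n ⊕ₗ Fin n) (Matrix.fromBlocks a 0 0 d) := by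
  constructor
  · rintro (i | i) (j | j) h
    · exact ha.1 (Sum.Lex.inl_lt_inl_iff.1 h)
    · rfl
    · rfl
    · exact hd.1 (Sum.Lex.inr_lt_inr_iff.1 h)
  · rintro (i | i)
    · exact ha.2 i
    · exact hd.2 i

/-- The projection `π : SB(2n) → G₊*` deleting the upper right block. -/
def proj {n : ℕ} (b : SB n) : GplusDual n :=
  ⟨⟨Matrix.fromBlocks b.1.1.toBlocks₁₁ 0 0 b.1.1.toBlocks₂₂, by
      have h := b.1.2
      rw [← Matrix.fromBlocks_toBlocks b.1.1, SB.toBlocks₂₁ b.2, Matrix.det_fromBlocks_zero₂₁] at h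
      rw [Matrix.det_fromBlocks_zero₂₁, h]⟩,
    isPosTriangular_fromBlocks
      ⟨fun _ _ h => b.2.1 (Sum.Lex.inl_lt_inl_iff.2 h), fun i => b.2.2 (Sum.inl i)⟩
      ⟨fun _ _ h => b.2.1 (Sum.Lex.inr_lt_inr_iff.2 h), fun i => b.2.2 (Sum.inr i)⟩,
    Matrix.toBlocks_fromBlocks₁₂ _ _ _ _⟩

/-- The momentum map `Φ₊(K) = (π(b_L), π(b_R))`. -/
noncomputable def PhiPlus {n : ℕ} (K : SL n) : GplusDual n × GplusDual n :=
  (proj (bL K), proj (bR K))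

/-- The constraint surface `Φ₊⁻¹(μ)`. -/
def ConstraintSurface {n : ℕ} (μ : GplusDual n × GplusDual n) : Set (SL n) := PhiPlus ⁻¹' {μ}

/-! ### The gauge group and its action on the constraint surface -/

/-- The isotropy group of `β ∈ G₊*` under the action of `G₊` on `G₊*` that sends `β` to the
`β'` with `β' β'† = η β β† η⁻¹`. -/
def isotropyGroup {n : ℕ} (β : GplusDual n) : Subgroup (Gplus n) where
  carrier := {η | η.1.1 * (β.1.1 * (β.1.1)ᴴ) * (η⁻¹).1.1 = β.1.1 * (β.1.1)ᴴ}
  mul_mem' {a b} ha hb := by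
    simp only [Set.mem_ofPred_eq, mul_inv_rev, Subgroup.coe_mul,
      Matrix.SpecialLinearGroup.coe_mul] at *
    conv_rhs => rw [← ha, ← hb]
    simp only [Matrix.mul_assoc]
  one_mem' := by simp
  inv_mem' {a} ha := by
    simp only [Set.mem_ofPred_eq, inv_inv] at *
    have h1 : (a⁻¹).1.1 * a.1.1 = 1 := coe_inv_mul_coe a.1
    conv_lhs => rw [← ha]
    simp only [Matrix.mul_assoc]
    rw [h1, Matrix.mul_one, ← Matrix.mul_assoc, h1, Matrix.one_mul]

/-- The gauge group `G_μ`, the isotropy group of `μ = (μ_L, μ_R)` in `G₊ × G₊`. -/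
def gaugeGroup {n : ℕ} (μ : GplusDual n × GplusDual n) : Subgroup (Gplus n × Gplus n) :=
  (isotropyGroup μ.1).prod (isotropyGroup μ.2)

/-- If `η` fixes `π(b)`, then `η b = b' h` with `h ∈ SU(2n)` and `π(b') = π(b)`. -/
theorem dressing {n : ℕ} (b : SB n) (η : Gplus n) (hη : η ∈ isotropyGroup (proj b)) :
    ∃ b' : SB n, ∃ h : SU n, (η : SL n) * (b : SL n) = (b' : SL n) * (h : SL n) ∧
      proj b' = proj b := by
  set β := proj b with hβ
  let h : SL n := (β : SL n)⁻¹ * η * β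
  have hh : h ∈ SU n := by
    have h1 : η.1.1 * (η⁻¹).1.1 = 1 := coe_mul_coe_inv η.1
    have h1' : (η.1.1)ᴴ * η.1.1 = 1 := Matrix.mem_unitaryGroup_iff'.1 η.2.1
    have h2 : (η⁻¹).1.1 = (η.1.1)ᴴ := by
      rw [← Matrix.one_mul (η⁻¹).1.1, ← h1', Matrix.mul_assoc, h1, Matrix.mul_one]
    have h3 : η.1.1 * (β.1.1 * (β.1.1)ᴴ) * (η⁻¹).1.1 = β.1.1 * (β.1.1)ᴴ := hη
    have h4 : (β.1⁻¹).1 * β.1.1 = 1 := coe_inv_mul_coe _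
    rw [SU.mem_iff]
    simp only [h, Matrix.SpecialLinearGroup.coe_mul, Matrix.conjTranspose_mul]
    rw [h2] at h3
    calc (β.1⁻¹).1 * η.1.1 * β.1.1 * ((β.1.1)ᴴ * ((η.1.1)ᴴ * ((β.1⁻¹).1)ᴴ))
        = (β.1⁻¹).1 * (η.1.1 * (β.1.1 * (β.1.1)ᴴ) * (η.1.1)ᴴ) * ((β.1⁻¹).1)ᴴ := by
          simp only [Matrix.mul_assoc]
      _ = ((β.1⁻¹).1 * β.1.1) * ((β.1⁻¹).1 * β.1.1)ᴴ := by
          rw [h3, Matrix.conjTranspose_mul]; simp only [Matrix.mul_assoc]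
      _ = 1 := by rw [h4]; simp
  -- `b = u β` with `u` block-unipotent, and `η b h⁻¹ = η u η⁻¹ β`.
  let u : SL n := (b : SL n) * (β : SL n)⁻¹
  have hβ21 : β.1.1.toBlocks₂₁ = 0 := SB.toBlocks₂₁ β.2.1
  have hb21 : b.1.1.toBlocks₂₁ = 0 := SB.toBlocks₂₁ b.2
  have hβi : (β.1⁻¹) ∈ GplusDual n := inv_mem β.2
  let c : SL n := η * b * h⁻¹
  have hβ11 : β.1.1.toBlocks₁₁ = b.1.1.toBlocks₁₁ := Matrix.toBlocks_fromBlocks₁₁ _ _ _ _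
  have hβ22 : β.1.1.toBlocks₂₂ = b.1.1.toBlocks₂₂ := Matrix.toBlocks_fromBlocks₂₂ _ _ _ _
  have hceq : c = η * u * (η : SL n)⁻¹ * β := by
    simp only [c, u, h, mul_inv_rev, inv_inv]
    group
  have hηi : (η⁻¹).1 ∈ Gplus n := (η⁻¹).2
  -- blocks of `u`
  have hu : u.1.toBlocks₁₁ = 1 ∧ u.1.toBlocks₂₁ = 0 ∧ u.1.toBlocks₂₂ = 1 := by
    have e1 : u.1 = b.1.1 * (β.1⁻¹).1 := rfl
    have e2 := coe_mul_coe_inv β.1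
    rw [← Matrix.fromBlocks_toBlocks β.1.1, ← Matrix.fromBlocks_toBlocks (β.1⁻¹).1,
      Matrix.fromBlocks_multiply, ← Matrix.fromBlocks_one, hβ21, β.2.2, hβi.2,
      SB.toBlocks₂₁ hβi.1, hβ11, hβ22] at e2
    obtain ⟨f1, -, -, f2⟩ := Matrix.fromBlocks_inj.1 e2
    rw [← Matrix.fromBlocks_toBlocks b.1.1, ← Matrix.fromBlocks_toBlocks (β.1⁻¹).1,
      Matrix.fromBlocks_multiply, hb21, hβi.2, SB.toBlocks₂₁ hβi.1] at e1
    rw [e1]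
    simp only [Matrix.mul_zero, add_zero, Matrix.zero_mul, zero_add] at f1 f2
    simp only [Matrix.mul_zero, add_zero, Matrix.zero_mul, zero_add, f1, f2,
      Matrix.toBlocks_fromBlocks₁₁, Matrix.toBlocks_fromBlocks₂₁, Matrix.toBlocks_fromBlocks₂₂,
      and_self]
  have hcb : c.1 = Matrix.fromBlocks b.1.1.toBlocks₁₁ c.1.toBlocks₁₂ 0 b.1.1.toBlocks₂₂ := by
    have e0 : c.1 = η.1.1 * u.1 * (η⁻¹).1.1 * β.1.1 := congrArg Subtype.val hceq
    have e2 := coe_mul_coe_inv η.1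
    change η.1.1 * (η⁻¹).1.1 = 1 at e2
    rw [← Matrix.fromBlocks_toBlocks η.1.1, ← Matrix.fromBlocks_toBlocks (η⁻¹).1.1,
      Matrix.fromBlocks_multiply, ← Matrix.fromBlocks_one, η.2.2.1, η.2.2.2, hηi.2.1,
      hηi.2.2] at e2
    obtain ⟨f1, -, -, f2⟩ := Matrix.fromBlocks_inj.1 e2
    simp only [Matrix.mul_zero, add_zero, zero_add] at f1 f2
    rw [← Matrix.fromBlocks_toBlocks η.1.1, ← Matrix.fromBlocks_toBlocks (η⁻¹).1.1,
      ← Matrix.fromBlocks_toBlocks u.1, ← Matrix.fromBlocks_toBlocks β.1.1,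
      η.2.2.1, η.2.2.2, hηi.2.1, hηi.2.2, hu.1, hu.2.1, hu.2.2, hβ21, β.2.2, hβ11, hβ22,
      Matrix.fromBlocks_multiply, Matrix.fromBlocks_multiply, Matrix.fromBlocks_multiply] at e0
    simp only [Matrix.mul_zero, add_zero, Matrix.zero_mul, zero_add, Matrix.mul_one, f1, f2,
      Matrix.one_mul] at e0
    rw [e0]
    simp
  have hc11 : c.1.toBlocks₁₁ = b.1.1.toBlocks₁₁ := by rw [hcb]; simp
  have hc22 : c.1.toBlocks₂₂ = b.1.1.toBlocks₂₂ := by rw [hcb]; simp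
  have hcSB : c ∈ SB n := by
    constructor
    · rintro (i | i) (j | j) hij
      · exact (congrFun (congrFun hc11 i) j).trans (b.2.1 hij)
      · exact absurd hij (Sum.Lex.not_inr_lt_inl)
      · rw [hcb]; rfl
      · exact (congrFun (congrFun hc22 i) j).trans (b.2.1 hij)
    · rintro (i | i)
      · obtain ⟨r, hr, e⟩ := b.2.2 (Sum.inl i)
        exact ⟨r, hr, (congrFun (congrFun hc11 i) i).trans e⟩
      · obtain ⟨r, hr, e⟩ := b.2.2 (Sum.inr i)
        exact ⟨r, hr, (congrFun (congrFun hc22 i) i).trans e⟩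
  refine ⟨⟨c, hcSB⟩, ⟨h, hh⟩, by simp [c], ?_⟩
  apply Subtype.ext
  apply Subtype.ext
  change Matrix.fromBlocks c.1.toBlocks₁₁ 0 0 c.1.toBlocks₂₂
    = Matrix.fromBlocks b.1.1.toBlocks₁₁ 0 0 b.1.1.toBlocks₂₂
  rw [hc11, hc22]

/-- The gauge group preserves the constraint surface. -/
theorem gauge_mem {n : ℕ} {μ : GplusDual n × GplusDual n} (g : gaugeGroup μ) {K : SL n}
    (hK : K ∈ ConstraintSurface μ) :
    (g.1.1 : SL n) * K * (g.1.2 : SL n)⁻¹ ∈ ConstraintSurface μ := by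
  obtain ⟨⟨ηL, ηR⟩, hL, hR⟩ := g
  have hK' : PhiPlus K = μ := hK
  have hKL : proj (bL K) = μ.1 := congrArg Prod.fst hK'
  have hKR : proj (bR K) = μ.2 := congrArg Prod.snd hK'
  obtain ⟨gR, h1⟩ := (bL_eq_iff K _).1 rfl
  obtain ⟨gL, h2⟩ := (bR_eq_iff K _).1 rfl
  obtain ⟨b, h, e1, e2⟩ := dressing (bL K) ηL (hKL ▸ hL)
  obtain ⟨b', h', e1', e2'⟩ := dressing (bR K) ηR (hKR ▸ hR)
  change (ηL : SL n) * K * (ηR : SL n)⁻¹ ∈ _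
  have hL' : bL ((ηL : SL n) * K * (ηR : SL n)⁻¹) = b := by
    rw [bL_eq_iff]
    refine ⟨⟨(h * (gR : SL n)⁻¹ * (ηR : SL n)⁻¹)⁻¹,
      inv_mem (mul_mem (mul_mem h.2 (inv_mem gR.2)) (inv_mem ηR.2.1))⟩, ?_⟩
    conv_lhs => rw [h1]
    simp only [inv_inv]
    rw [← mul_assoc, e1]
    simp only [mul_assoc]
  have hR' : bR ((ηL : SL n) * K * (ηR : SL n)⁻¹) = b' := by
    rw [bR_eq_iff]
    refine ⟨⟨(ηL : SL n) * gL * (h' : SL n)⁻¹,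
      mul_mem (mul_mem ηL.2.1 gL.2) (inv_mem h'.2)⟩, ?_⟩
    conv_lhs => rw [h2]
    have e3 := congrArg (·⁻¹) e1'
    simp only [mul_inv_rev] at e3
    simp only [mul_assoc]
    rw [e3]
  change (proj (bL _), proj (bR _)) = μ
  rw [hL', hR', e2, e2', hKL, hKR]

/-- The gauge action `(η_L, η_R) • K = η_L K η_R⁻¹` of `G_μ` on `Φ₊⁻¹(μ)`. -/
instance gaugeAction {n : ℕ} (μ : GplusDual n × GplusDual n) :
    MulAction (gaugeGroup μ) (ConstraintSurface μ) where
  smul g K := ⟨(g.1.1 : SL n) * K.1 * (g.1.2 : SL n)⁻¹, gauge_mem g K.2⟩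
  one_smul K := by
    apply Subtype.ext
    change (1 : SL n) * K.1 * (1 : SL n)⁻¹ = K.1
    simp
  mul_smul g h K := by
    apply Subtype.ext
    change ((g.1.1 : SL n) * h.1.1) * K.1 * ((g.1.2 : SL n) * h.1.2)⁻¹
      = (g.1.1 : SL n) * ((h.1.1 : SL n) * K.1 * (h.1.2 : SL n)⁻¹) * (g.1.2 : SL n)⁻¹
    simp only [mul_inv_rev, mul_assoc]

/-! ### The effective gauge group -/

/-- The subgroup of `G₊ × G₊` consisting of the pairs `(η, η)` with `η = diag(z 1ₙ, z 1ₙ)` and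
`z ^ (2n) = 1`. -/
def centralSubgroup (n : ℕ) : Subgroup (Gplus n × Gplus n) where
  carrier := {g | g.1 = g.2 ∧ ∃ z : ℂ, z ^ (2 * n) = 1 ∧
    g.1.1.1 = Matrix.fromBlocks (z • 1) 0 0 (z • 1)}
  mul_mem' := by
    rintro a b ⟨ha, z, hz, ha'⟩ ⟨hb, w, hw, hb'⟩
    refine ⟨by rw [Prod.fst_mul, Prod.snd_mul, ha, hb], z * w, by rw [mul_pow, hz, hw, one_mul], ?_⟩
    rw [Prod.fst_mul, Subgroup.coe_mul, Matrix.SpecialLinearGroup.coe_mul, ha', hb',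
      Matrix.fromBlocks_multiply]
    simp [smul_smul, mul_comm]
  one_mem' := ⟨rfl, 1, one_pow _, by simp⟩
  inv_mem' := by
    rintro a ⟨ha, z, hz, ha'⟩
    refine ⟨by rw [Prod.fst_inv, Prod.snd_inv, ha], z⁻¹, by rw [inv_pow, hz, inv_one], ?_⟩
    rcases Nat.eq_zero_or_pos n with rfl | hn
    · ext i; rcases i with i | i <;> exact i.elim0
    have hz0 : z ≠ 0 := by
      rintro rfl
      rw [zero_pow (by omega)] at hz
      exact zero_ne_one hz
    have h1 : (a.1⁻¹).1.1 * a.1.1.1 = 1 := coe_inv_mul_coe a.1.1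
    have h2 : a.1.1.1 * Matrix.fromBlocks (z⁻¹ • 1) 0 0 (z⁻¹ • 1) = 1 := by
      rw [ha', Matrix.fromBlocks_multiply]
      simp [smul_smul, hz0]
    rw [Prod.fst_inv, ← Matrix.mul_one (a.1⁻¹).1.1, ← h2, ← Matrix.mul_assoc, h1, Matrix.one_mul]

theorem centralSubgroup.commute {n : ℕ} {c : Gplus n × Gplus n} (hc : c ∈ centralSubgroup n)
    (K : SL n) : (c.1 : SL n) * K = K * (c.1 : SL n) := by
  obtain ⟨-, z, -, hz⟩ := hc
  have h : c.1.1.1 = z • (1 : Matrix (Idx n) (Idx n) ℂ) := by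
    rw [hz, ← Matrix.fromBlocks_one, Matrix.fromBlocks_smul]; simp
  apply Subtype.ext
  change c.1.1.1 * K.1 = K.1 * c.1.1.1
  rw [h]; simp

instance centralSubgroup.normal (n : ℕ) : (centralSubgroup n).Normal where
  conj_mem c hc g := by
    have h : g * c * g⁻¹ = c := by
      have h1 := centralSubgroup.commute hc (g.1 : SL n)
      have h2 := centralSubgroup.commute hc (g.2 : SL n)
      rw [mul_inv_eq_iff_eq_mul]
      refine Prod.ext (Subtype.ext h1.symm) (Subtype.ext ?_)
      rw [hc.1] at h2
      exact h2.symm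
    rw [h]; exact hc

theorem centralSubgroup_le_gaugeGroup {n : ℕ} (μ : GplusDual n × GplusDual n) :
    centralSubgroup n ≤ gaugeGroup μ := by
  have key : ∀ c ∈ centralSubgroup n, ∀ β : GplusDual n, c.1 ∈ isotropyGroup β := by
    rintro c ⟨-, z, -, hz⟩ β
    have h : c.1.1.1 = z • (1 : Matrix (Idx n) (Idx n) ℂ) := by
      rw [hz, ← Matrix.fromBlocks_one, Matrix.fromBlocks_smul]; simp
    have h1 : c.1.1.1 * (c.1⁻¹).1.1 = 1 := coe_mul_coe_inv c.1.1
    change c.1.1.1 * (β.1.1 * (β.1.1)ᴴ) * (c.1⁻¹).1.1 = _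
    have h2 : c.1.1.1 * (β.1.1 * (β.1.1)ᴴ) = (β.1.1 * (β.1.1)ᴴ) * c.1.1.1 := by rw [h]; simp
    rw [h2, Matrix.mul_assoc, h1, Matrix.mul_one]
  intro c hc
  exact ⟨key c hc _, hc.1 ▸ key c hc _⟩

/-- The effective gauge group `Ḡ_μ`. -/
abbrev EffectiveGaugeGroup {n : ℕ} (μ : GplusDual n × GplusDual n) : Type :=
  gaugeGroup μ ⧸ (centralSubgroup n).subgroupOf (gaugeGroup μ)

theorem central_smul {n : ℕ} {μ : GplusDual n × GplusDual n} {c : gaugeGroup μ}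
    (hc : c ∈ (centralSubgroup n).subgroupOf (gaugeGroup μ)) (K : ConstraintSurface μ) :
    c • K = K := by
  apply Subtype.ext
  change (c.1.1 : SL n) * K.1 * (c.1.2 : SL n)⁻¹ = K.1
  have hc' : c.1 ∈ centralSubgroup n := hc
  rw [centralSubgroup.commute hc', hc'.1]
  simp

/-- The action of `Ḡ_μ` on `Φ₊⁻¹(μ)` induced by the gauge action of `G_μ`. -/
instance effectiveGaugeAction {n : ℕ} (μ : GplusDual n × GplusDual n) :
    MulAction (EffectiveGaugeGroup μ) (ConstraintSurface μ) :=
  MulAction.compHom (ConstraintSurface μ)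
    (QuotientGroup.lift ((centralSubgroup n).subgroupOf (gaugeGroup μ))
      (MulAction.toPermHom (gaugeGroup μ) (ConstraintSurface μ))
      (fun _ hc => Equiv.ext fun K => central_smul hc K))

theorem mk_smul {n : ℕ} {μ : GplusDual n × GplusDual n} (g : gaugeGroup μ)
    (K : ConstraintSurface μ) : (QuotientGroup.mk g : EffectiveGaugeGroup μ) • K = g • K := rfl

theorem coe_smul {n : ℕ} {μ : GplusDual n × GplusDual n} (g : gaugeGroup μ)
    (K : ConstraintSurface μ) :
    ((g • K : ConstraintSurface μ) : SL n) = (g.1.1 : SL n) * K.1 * (g.1.2 : SL n)⁻¹ := rfl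

/-! ### The momentum map value -/

/-- The upper triangular matrix `ν(x)`. -/
noncomputable def nu (n : ℕ) (x : ℝ) : Matrix (Fin n) (Fin n) ℂ := Matrix.of fun j k =>
  if j = k then 1
  else if j < k then (((1 - Real.exp (-x)) * Real.exp (((k : ℝ) - (j : ℝ)) * x / 2) : ℝ) : ℂ)
  else 0

theorem nu_blockTriangular (n : ℕ) (x : ℝ) : (nu n x).BlockTriangular (id : Fin n → Fin n) := by
  intro i j h
  have h' : j < i := h
  simp [nu, h'.ne', h'.not_gt]

theorem det_nu (n : ℕ) (x : ℝ) : (nu n x).det = 1 := by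
  rw [Matrix.det_of_isUpperTriangular (nu_blockTriangular n x)]
  exact Finset.prod_eq_one fun i _ => by simp [nu]

theorem isPosTriangular_smul {n : ℕ} (t : ℝ) {a : Matrix (Fin n) (Fin n) ℂ}
    (ha : IsPosTriangular (id : Fin n → Fin n) a) :
    IsPosTriangular (id : Fin n → Fin n) ((Real.exp t : ℂ) • a) := by
  refine ⟨fun i j h => by rw [Matrix.smul_apply, ha.1 h, smul_zero], fun i => ?_⟩
  obtain ⟨r, hr, h⟩ := ha.2 i
  exact ⟨Real.exp t * r, mul_pos (Real.exp_pos _) hr, by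
    rw [Matrix.smul_apply, h, smul_eq_mul]; push_cast; rfl⟩

/-- `diag(e^t a, e^{-t} 1ₙ) ∈ G₊*` for upper triangular `a` of determinant one with positive
diagonal. -/
noncomputable def blockDiagDual {n : ℕ} (t : ℝ) (a : Matrix (Fin n) (Fin n) ℂ)
    (ha : IsPosTriangular (id : Fin n → Fin n) a) (hdet : a.det = 1) : GplusDual n :=
  ⟨⟨Matrix.fromBlocks ((Real.exp t : ℂ) • a) 0 0 ((Real.exp (-t) : ℂ) • 1), by
      rw [Matrix.det_fromBlocks_zero₂₁, Matrix.det_smul, Matrix.det_smul, hdet, Matrix.det_one,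
        mul_one, mul_one, ← mul_pow, ← Complex.ofReal_mul, ← Real.exp_add]
      simp⟩,
    isPosTriangular_fromBlocks (isPosTriangular_smul t ha)
      (isPosTriangular_smul (-t) (IsPosTriangular.one _)),
    Matrix.toBlocks_fromBlocks₁₂ _ _ _ _⟩

/-- `μ_L = diag(e^u ν(x), e^{-u} 1ₙ)`. -/
noncomputable def muL (n : ℕ) (u x : ℝ) : GplusDual n :=
  blockDiagDual u (nu n x) ⟨nu_blockTriangular n x, fun i => ⟨1, one_pos, by simp [nu]⟩⟩
    (det_nu n x)

/-- `μ_R = diag(e^v 1ₙ, e^{-v} 1ₙ)`. -/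
noncomputable def muR (n : ℕ) (v : ℝ) : GplusDual n :=
  blockDiagDual v 1 (IsPosTriangular.one _) Matrix.det_one

/-- The momentum map value `μ = (μ_L, μ_R)`. -/
noncomputable def mu (n : ℕ) (u v x : ℝ) : GplusDual n × GplusDual n := (muL n u x, muR n v)

/-- `G₊(μ_L)` consists of the `η ∈ G₊` whose first block fixes `ν(x) ν(x)†` under conjugation. -/
theorem mem_isotropyGroup_muL_iff {n : ℕ} {u x : ℝ} {η : Gplus n} :
    η ∈ isotropyGroup (muL n u x) ↔
      η.1.1.toBlocks₁₁ * (nu n x * (nu n x)ᴴ) * (η⁻¹).1.1.toBlocks₁₁ = nu n x * (nu n x)ᴴ := by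
  have he : η.1.1 * (η⁻¹).1.1 = 1 := coe_mul_coe_inv η.1
  have hηi : (η⁻¹).1 ∈ Gplus n := (η⁻¹).2
  change η.1.1 * (Matrix.fromBlocks _ _ _ _ * (Matrix.fromBlocks _ _ _ _)ᴴ) * (η⁻¹).1.1
    = Matrix.fromBlocks _ _ _ _ * (Matrix.fromBlocks _ _ _ _)ᴴ ↔ _
  rw [← Matrix.fromBlocks_toBlocks η.1.1, ← Matrix.fromBlocks_toBlocks (η⁻¹).1.1,
    η.2.2.1, η.2.2.2, hηi.2.1, hηi.2.2] at he ⊢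
  rw [Matrix.fromBlocks_multiply, ← Matrix.fromBlocks_one] at he
  obtain ⟨-, -, -, f2⟩ := Matrix.fromBlocks_inj.1 he
  simp only [Matrix.mul_zero, zero_add] at f2
  have hu : ((Real.exp u : ℝ) : ℂ) ≠ 0 := by exact_mod_cast (Real.exp_pos u).ne'
  have hc : star ((Real.exp u : ℝ) : ℂ) * (Real.exp u : ℂ) ≠ 0 := mul_ne_zero (star_ne_zero.2 hu) hu
  rw [Matrix.fromBlocks_conjTranspose]
  simp only [Matrix.fromBlocks_multiply, Matrix.fromBlocks_inj, Matrix.conjTranspose_zero,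
    Matrix.conjTranspose_smul, Matrix.mul_zero, Matrix.zero_mul, add_zero, zero_add, smul_zero,
    Matrix.mul_smul, Matrix.smul_mul, smul_smul, Matrix.conjTranspose_one, Matrix.mul_one, f2,
    Matrix.toBlocks_fromBlocks₁₁, and_self, and_true]
  exact (smul_right_injective (Matrix (Fin n) (Fin n) ℂ) hc).eq_iff

theorem isotropyGroup_muR (n : ℕ) (v : ℝ) : isotropyGroup (muR n v) = ⊤ := by
  rw [eq_top_iff]
  intro η _
  have he : η.1.1 * (η⁻¹).1.1 = 1 := coe_mul_coe_inv η.1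
  have hηi : (η⁻¹).1 ∈ Gplus n := (η⁻¹).2
  change η.1.1 * (Matrix.fromBlocks _ _ _ _ * (Matrix.fromBlocks _ _ _ _)ᴴ) * (η⁻¹).1.1
    = Matrix.fromBlocks _ _ _ _ * (Matrix.fromBlocks _ _ _ _)ᴴ
  rw [← Matrix.fromBlocks_toBlocks η.1.1, ← Matrix.fromBlocks_toBlocks (η⁻¹).1.1,
    η.2.2.1, η.2.2.2, hηi.2.1, hηi.2.2] at he ⊢
  rw [Matrix.fromBlocks_multiply, ← Matrix.fromBlocks_one] at he
  obtain ⟨f1, -, -, f2⟩ := Matrix.fromBlocks_inj.1 he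
  simp only [Matrix.mul_zero, zero_add, add_zero] at f1 f2
  rw [Matrix.fromBlocks_conjTranspose]
  simp only [Matrix.fromBlocks_multiply, Matrix.conjTranspose_zero,
    Matrix.conjTranspose_smul, Matrix.mul_zero, Matrix.zero_mul, add_zero, zero_add, smul_zero,
    Matrix.mul_smul, Matrix.smul_mul, smul_smul, Matrix.conjTranspose_one, Matrix.mul_one, f1, f2]

end HeisenbergDouble

namespace HeisenbergDouble

/-! Let `K` have blocks `A, B, C, D` and `K⁻¹` blocks `A', B', C', D'`. A pair fixing `K` is
`diag(a, d)`, `diag(a', d')` with unitary blocks and `diag(a, d) K = K diag(a', d')`. It suffices to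
find one scalar `z` equal to all four blocks: `det = 1` then gives `z ^ (2n) = 1`, so the stabilizer
is the central subgroup that is divided out.

The constraints enter only through quadratic relations among the blocks of `K` and `K⁻¹`, free of
the undetermined upper right blocks of `b_L` and `b_R` (`iwasawa_block_relations`). Their right-hand
sides are `α = e^{-2v}` and `β = e^{-2u}`. Since `u < v` means `α < β`, the block `D` is invertible;
since `v ≠ -u` means `αβ ≠ 1`, so is `C`. Thus `d` is similar to both `a'` and `d'`, and `K` itself
makes `diag(a, d)` similar to `diag(a', d')`.

The matrix `ν ν†` is `q = e^{-x}` plus a nonzero multiple of `w w†` (`nu_mul_conjTranspose`). As `a`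
commutes with it, `a w = z w` for some `z`. Put `F = (a - z)†(a - z)` and `F' = (a' - z)†(a' - z)`;
the similarities give `tr F = tr F'`, and `F w = 0` gives `ν ν† F = q F`. Tested against `F` and
`F'`, the `α` relations say `tr(C'†C'F) = tr(C†CF')` and the `β` relations say `q tr(C'†C'F) =
tr(C†CF')`. Since `q ≠ 1`, both vanish; invertibility of `C` forces `a' = z`, and equality of the
traces forces the rest (`blocks_eq_smul_one`). -/

/-- The positive semidefinite matrix `(y - z)† (y - z)`. -/
def sqDist {m : Type*} [Fintype m] [DecidableEq m] (z : ℂ) (y : Matrix m m ℂ) : Matrix m m ℂ :=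
  (y - z • 1)ᴴ * (y - z • 1)

/-! ### Intertwined unitaries and their distance to a scalar -/

section MatrixLemmas

open scoped ComplexOrder

variable {m : Type*} [Fintype m] [DecidableEq m]

/-- For unitary matrices the adjoint is the inverse, so an intertwining relation passes to adjoints
even when `A` is singular. -/
theorem conjTranspose_intertwine {a a' A : Matrix m m ℂ} (ha : aᴴ * a = 1) (ha' : a' * a'ᴴ = 1)
    (h : a * A = A * a') : aᴴ * A = A * a'ᴴ := by
  calc aᴴ * A = aᴴ * (A * a') * a'ᴴ := by rw [Matrix.mul_assoc, Matrix.mul_assoc, ha', Matrix.mul_one]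
    _ = (aᴴ * a) * A * a'ᴴ := by rw [← h]; simp only [Matrix.mul_assoc]
    _ = A * a'ᴴ := by rw [ha, Matrix.one_mul]

theorem sqDist_intertwine {a a' A : Matrix m m ℂ} (ha : aᴴ * a = 1) (ha' : a' * a'ᴴ = 1)
    (h : a * A = A * a') (z : ℂ) : sqDist z a * A = A * sqDist z a' := by
  have h' := conjTranspose_intertwine ha ha' h
  have e1 : (a - z • 1) * A = A * (a' - z • 1) := by
    rw [Matrix.sub_mul, Matrix.mul_sub, h]; simp
  have e2 : (a - z • 1)ᴴ * A = A * (a' - z • 1)ᴴ := by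
    rw [Matrix.conjTranspose_sub, Matrix.conjTranspose_sub, Matrix.sub_mul, Matrix.mul_sub, h']
    simp
  rw [sqDist, sqDist, Matrix.mul_assoc, e1, ← Matrix.mul_assoc, e2, Matrix.mul_assoc]

/-- An invertible intertwiner makes the two matrices `sqDist` similar. The trace is the squared
Hilbert–Schmidt distance to `z • 1`, so it also detects equality with that scalar. -/
theorem trace_sqDist_eq {a a' A : Matrix m m ℂ} (ha : aᴴ * a = 1) (ha' : a' * a'ᴴ = 1)
    (h : a * A = A * a') (hA : IsUnit A.det) (z : ℂ) :
    (sqDist z a).trace = (sqDist z a').trace := by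
  have e : sqDist z a = A * sqDist z a' * A⁻¹ := by
    rw [← sqDist_intertwine ha ha' h, Matrix.mul_assoc, Matrix.mul_nonsing_inv _ hA, Matrix.mul_one]
  rw [e, Matrix.trace_mul_comm, ← Matrix.mul_assoc, Matrix.nonsing_inv_mul _ hA, Matrix.one_mul]

theorem eq_smul_one_of_trace_sqDist {z : ℂ} {y : Matrix m m ℂ} (h : (sqDist z y).trace = 0) :
    y = z • 1 :=
  sub_eq_zero.1 (Matrix.trace_conjTranspose_mul_self_eq_zero_iff.1 h)

/-- By cyclicity the trace is the squared Hilbert–Schmidt norm of `C (y - z)†`, and `C` can be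
cancelled. -/
theorem eq_smul_one_of_trace_mul_sqDist {z : ℂ} {y C : Matrix m m ℂ} (hC : IsUnit C.det)
    (h : (Cᴴ * C * sqDist z y).trace = 0) : y = z • 1 := by
  have h1 : ((C * (y - z • 1)ᴴ) * (C * (y - z • 1)ᴴ)ᴴ).trace = 0 := by
    rw [← h, sqDist, Matrix.conjTranspose_mul, Matrix.conjTranspose_conjTranspose,
      Matrix.mul_assoc Cᴴ, Matrix.trace_mul_comm Cᴴ]
    simp only [Matrix.mul_assoc]
  have h2 := Matrix.trace_mul_conjTranspose_self_eq_zero_iff.1 h1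
  have h3 : (y - z • 1)ᴴ = 0 := by
    rw [← Matrix.nonsing_inv_mul_cancel_left C (y - z • 1)ᴴ hC, h2, Matrix.mul_zero]
  exact sub_eq_zero.1 (Matrix.conjTranspose_eq_zero.1 h3)

/-! ### Invertibility of the lower blocks -/

theorem isUnit_det_of_conjTranspose_mulVec {C : Matrix m m ℂ}
    (h : ∀ y : m → ℂ, Cᴴ *ᵥ y = 0 → y = 0) : IsUnit C.det := by
  rw [isUnit_iff_ne_zero]
  intro h0
  have h1 : Cᴴ.det = 0 := by rw [Matrix.det_conjTranspose, h0, star_zero]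
  obtain ⟨y, hy, hy'⟩ := Matrix.exists_mulVec_eq_zero_iff.2 h1
  exact hy (h y hy')

/-- If the bottom rows of `K` and `K⁻¹` have prescribed norms `β`, `α` with `β α ≠ 1`, then the lower
left block of `K` is invertible. -/
theorem isUnit_det_lowerLeft {C D A' B' C' D' : Matrix m m ℂ} {α β : ℂ} (hαβ : β * α ≠ 1)
    (h2 : C * Cᴴ + D * Dᴴ = β • 1) (h3 : C' * C'ᴴ + D' * D'ᴴ = α • 1)
    (hKL : C * B' + D * D' = 1) (hLK : A'ᴴ * Cᴴ + C'ᴴ * Dᴴ = 0) : IsUnit C.det := by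
  refine isUnit_det_of_conjTranspose_mulVec fun y hy => ?_
  have hy' : star y ᵥ* C = 0 := by
    rw [← Matrix.conjTranspose_conjTranspose C, ← Matrix.star_mulVec, hy, star_zero]
  -- With `C†y = 0`, the vector `D†y` is sent to `0` by `C'†` and to `y` by `D'†`. The norm
  -- relations then give `D'y = α D†y` and `D D†y = β y`, so `D D'y = αβ y`.
  have e1 : C'ᴴ *ᵥ (Dᴴ *ᵥ y) = 0 := by
    have := congrArg (· *ᵥ y) hLK
    simpa [Matrix.add_mulVec, ← Matrix.mulVec_mulVec, hy] using this
  have e2 : D'ᴴ *ᵥ (Dᴴ *ᵥ y) = y := by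
    have := congrArg (fun N => Nᴴ *ᵥ y) hKL
    simpa [Matrix.add_mulVec, ← Matrix.mulVec_mulVec, hy] using this
  have e3 : D' *ᵥ y = α • (Dᴴ *ᵥ y) := by
    have := congrArg (· *ᵥ (Dᴴ *ᵥ y)) h3
    simpa [Matrix.add_mulVec, ← Matrix.mulVec_mulVec, e1, e2, Matrix.smul_mulVec] using this
  have e4 : D *ᵥ (Dᴴ *ᵥ y) = β • y := by
    have := congrArg (· *ᵥ y) h2
    simpa [Matrix.add_mulVec, ← Matrix.mulVec_mulVec, hy, Matrix.smul_mulVec] using this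
  have e5 : C *ᵥ (B' *ᵥ y) + (α * β) • y = y := by
    have := congrArg (· *ᵥ y) hKL
    simpa [Matrix.add_mulVec, ← Matrix.mulVec_mulVec, e3, e4, Matrix.mulVec_smul, smul_smul]
      using this
  -- Pairing with `y` removes the unknown term `C B'y`, because `y†C = 0`.
  have e6 := congrArg (star y ⬝ᵥ ·) e5
  simp only [dotProduct_add, Matrix.dotProduct_mulVec, hy', Matrix.zero_vecMul, zero_dotProduct,
    zero_add, dotProduct_smul, smul_eq_mul] at e6
  have e7 : (β * α - 1) * (star y ⬝ᵥ y) = 0 := by linear_combination e6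
  exact dotProduct_star_self_eq_zero.1 ((mul_eq_zero.1 e7).resolve_left (sub_ne_zero.2 hαβ))

/-- If the left column of `K` has norm `α` and the bottom row has norm `β > α`, then the lower right
block of `K` is invertible. -/
theorem isUnit_det_lowerRight {A C D : Matrix m m ℂ} {α β : ℝ} (hαβ : α < β) (hβ : 0 < β)
    (h1 : Aᴴ * A + Cᴴ * C = (α : ℂ) • 1) (h2 : C * Cᴴ + D * Dᴴ = (β : ℂ) • 1) :
    IsUnit D.det := by
  refine isUnit_det_of_conjTranspose_mulVec fun y hy => ?_
  have e1 : C *ᵥ (Cᴴ *ᵥ y) = (β : ℂ) • y := by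
    have := congrArg (· *ᵥ y) h2
    simpa [Matrix.add_mulVec, ← Matrix.mulVec_mulVec, hy, Matrix.smul_mulVec] using this
  set g := Cᴴ *ᵥ y with hg
  have e2 : Aᴴ *ᵥ (A *ᵥ g) + (β : ℂ) • g = (α : ℂ) • g := by
    have := congrArg (· *ᵥ g) h1
    simpa [Matrix.add_mulVec, ← Matrix.mulVec_mulVec, e1, Matrix.smul_mulVec, Matrix.mulVec_smul]
      using this
  -- Here `g = C†y` satisfies `C†C g = β g`, while `A†A + C†C = α`. So `‖A g‖² = (α - β)‖g‖²`, which
  -- is possible only for `g = 0`.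
  have e3 : star (A *ᵥ g) ⬝ᵥ (A *ᵥ g) = ((α - β : ℝ) : ℂ) * (star g ⬝ᵥ g) := by
    have := congrArg (star g ⬝ᵥ ·) e2
    simp only [dotProduct_add, Matrix.dotProduct_mulVec, dotProduct_smul, smul_eq_mul] at this
    rw [Matrix.star_mulVec, Matrix.dotProduct_mulVec]
    push_cast
    linear_combination this
  have hp : 0 ≤ star (A *ᵥ g) ⬝ᵥ (A *ᵥ g) := dotProduct_star_self_nonneg _
  have hq : 0 ≤ star g ⬝ᵥ g := dotProduct_star_self_nonneg _
  have e4 : star g ⬝ᵥ g = 0 := by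
    rw [e3] at hp
    rw [Complex.nonneg_iff] at hp hq
    rw [Complex.re_ofReal_mul] at hp
    refine Complex.ext (le_antisymm ?_ hq.1) hq.2.symm
    by_contra! hlt
    have := mul_neg_of_neg_of_pos (sub_neg.2 hαβ) hlt
    exact absurd hp.1 (not_le.2 this)
  have e5 : g = 0 := dotProduct_star_self_eq_zero.1 e4
  rw [e5, Matrix.mulVec_zero] at e1
  exact (smul_eq_zero.1 e1.symm).resolve_left (by exact_mod_cast hβ.ne')

/-! ### The rank one term and the trace comparison -/

/-- A matrix commuting with a nontrivial rank one perturbation of a scalar matrix has the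
perturbation vector as an eigenvector. -/
theorem exists_eigenvalue_of_commute {M a : Matrix m m ℂ} {q c : ℂ} {w : m → ℂ} (hc : c ≠ 0)
    (hw : w ≠ 0) (hM : M = q • 1 + c • Matrix.vecMulVec w (star w)) (h : a * M = M * a) :
    ∃ z : ℂ, a *ᵥ w = z • w := by
  have hn : star w ⬝ᵥ w ≠ 0 := fun h0 => hw (dotProduct_star_self_eq_zero.1 h0)
  have e : a * Matrix.vecMulVec w (star w) = Matrix.vecMulVec w (star w) * a := by
    rw [hM] at h
    simp only [Matrix.mul_add, Matrix.add_mul, Matrix.mul_smul, Matrix.smul_mul, Matrix.mul_one,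
      Matrix.one_mul, add_right_inj] at h
    exact smul_right_injective _ hc h
  -- Applying `a w w† = w w† a` to `w` puts `a w` on the line of `w`.
  have e1 : (star w ⬝ᵥ w) • (a *ᵥ w) = (star w ⬝ᵥ (a *ᵥ w)) • w := by
    have := congrArg (· *ᵥ w) e
    simpa [← Matrix.mulVec_mulVec, Matrix.vecMulVec_mulVec, Matrix.mulVec_smul] using this
  refine ⟨(star w ⬝ᵥ w)⁻¹ * (star w ⬝ᵥ (a *ᵥ w)), ?_⟩
  rw [mul_smul, ← e1, smul_smul, inv_mul_cancel₀ hn, one_smul]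

/-- Since `a - z` kills `w`, the rank one term of `M` is annihilated by `sqDist z a` from either
side; only the scalar part survives. -/
theorem mul_sqDist_of_eigenvector {M a : Matrix m m ℂ} {q c z : ℂ} {w : m → ℂ}
    (hM : M = q • 1 + c • Matrix.vecMulVec w (star w)) (hz : a *ᵥ w = z • w) :
    M * sqDist z a = q • sqDist z a ∧ sqDist z a * M = q • sqDist z a := by
  have h1 : (a - z • 1) * Matrix.vecMulVec w (star w) = 0 := by
    rw [Matrix.mul_vecMulVec, Matrix.sub_mulVec, hz, Matrix.smul_mulVec, Matrix.one_mulVec,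
      sub_self, Matrix.zero_vecMulVec]
  have h2 : Matrix.vecMulVec w (star w) * (a - z • 1)ᴴ = 0 := by
    have := congrArg Matrix.conjTranspose h1
    rwa [Matrix.conjTranspose_mul, Matrix.conjTranspose_vecMulVec, star_star,
      Matrix.conjTranspose_zero] at this
  constructor
  · rw [hM, Matrix.add_mul, Matrix.smul_mul, Matrix.smul_mul, Matrix.one_mul, sqDist,
      ← Matrix.mul_assoc (Matrix.vecMulVec _ _), h2, Matrix.zero_mul, smul_zero, add_zero]
  · rw [hM, Matrix.mul_add, Matrix.mul_smul, Matrix.mul_smul, Matrix.mul_one, sqDist,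
      Matrix.mul_assoc _ _ (Matrix.vecMulVec _ _), h1, Matrix.mul_zero, smul_zero, add_zero]

/-- The isotropy equations force all four diagonal blocks to be the same scalar matrix. -/
theorem blocks_eq_smul_one {A B C D A' C' a d a' d' M : Matrix m m ℂ}
    {α β q c : ℂ} {w : m → ℂ} (hq : q ≠ 1) (hc : c ≠ 0) (hw : w ≠ 0)
    (hM : M = q • 1 + c • Matrix.vecMulVec w (star w)) (haM : a * M = M * a)
    (hC : IsUnit C.det) (hD : IsUnit D.det) (hK : IsUnit (Matrix.fromBlocks A B C D).det)
    (h1 : Aᴴ * A + Cᴴ * C = α • 1) (h4 : A * Aᴴ + C'ᴴ * C' = α • 1)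
    (h5 : A' * M * A'ᴴ + Cᴴ * C = β • 1) (h6 : (A'ᴴ * A' + C'ᴴ * C') * M = β • 1)
    (ha : aᴴ * a = 1) (hd : dᴴ * d = 1) (ha' : a' * a'ᴴ = 1) (hd' : d' * d'ᴴ = 1)
    (hA : a * A = A * a') (hCi : d * C = C * a') (hDi : d * D = D * d')
    (hBi : a * B = B * d') (hA' : A' * a = a' * A') :
    ∃ z : ℂ, a = z • 1 ∧ d = z • 1 ∧ a' = z • 1 ∧ d' = z • 1 := by
  obtain ⟨z, hz⟩ := exists_eigenvalue_of_commute hc hw hM haM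
  obtain ⟨f1, f2⟩ := mul_sqDist_of_eigenvector hM hz
  have ha2 : a * aᴴ = 1 := mul_eq_one_comm.1 ha
  have ha'2 : a'ᴴ * a' = 1 := mul_eq_one_comm.1 ha'
  have td := trace_sqDist_eq hd ha' hCi hC z
  have td' := trace_sqDist_eq hd hd' hDi hD z
  have hsq : ∀ (p r : Matrix m m ℂ), sqDist z (Matrix.fromBlocks p 0 0 r) =
      Matrix.fromBlocks (sqDist z p) 0 0 (sqDist z r) := by
    intro p r
    rw [sqDist, ← Matrix.fromBlocks_one, Matrix.fromBlocks_smul, sub_eq_add_neg,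
      Matrix.fromBlocks_neg, Matrix.fromBlocks_add, Matrix.fromBlocks_conjTranspose,
      Matrix.fromBlocks_multiply]
    simp [sqDist, sub_eq_add_neg]
  -- `A` and `B` need not be invertible, so `a` is compared with `a'` through the whole of `K`: the
  -- contributions of `d` and `d'` cancel by `td'`.
  have tK := trace_sqDist_eq (a := Matrix.fromBlocks a 0 0 d) (a' := Matrix.fromBlocks a' 0 0 d')
    (by simp [Matrix.fromBlocks_conjTranspose, Matrix.fromBlocks_multiply, ha, hd])
    (by simp [Matrix.fromBlocks_conjTranspose, Matrix.fromBlocks_multiply, ha', hd'])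
    (by simp [Matrix.fromBlocks_multiply, hA, hBi, hCi, hDi]) hK z
  rw [hsq, hsq] at tK
  simp only [Matrix.trace, Fintype.sum_sum_type, Matrix.diag_apply, Matrix.fromBlocks_apply₁₁,
    Matrix.fromBlocks_apply₂₂] at tK
  have ta : (sqDist z a).trace = (sqDist z a').trace := by
    simp only [Matrix.trace, Matrix.diag_apply] at td' ⊢
    linear_combination tK - td'
  have iA := sqDist_intertwine ha ha' hA z
  have iA' := sqDist_intertwine ha'2 ha2 hA'.symm z
  set F := sqDist z a with hF
  set F' := sqDist z a' with hF'
  -- The norm relations are now tested against `F` or `F'`; the intertwiners `A` and `A'` carry one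
  -- test matrix to the other.
  have k1 : (Aᴴ * A * F').trace + (Cᴴ * C * F').trace = α * F'.trace := by
    rw [← Matrix.trace_add, ← Matrix.add_mul, h1]; simp
  have k4 : (A * Aᴴ * F).trace + (C'ᴴ * C' * F).trace = α * F.trace := by
    rw [← Matrix.trace_add, ← Matrix.add_mul, h4]; simp
  have k14 : (A * Aᴴ * F).trace = (Aᴴ * A * F').trace := by
    rw [Matrix.mul_assoc Aᴴ, ← iA, Matrix.mul_assoc, Matrix.trace_mul_comm, Matrix.mul_assoc]
  have k5 : (A' * M * A'ᴴ * F').trace + (Cᴴ * C * F').trace = β * F'.trace := by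
    rw [← Matrix.trace_add, ← Matrix.add_mul, h5]; simp
  have k6 : q * ((A'ᴴ * A' * F).trace + (C'ᴴ * C' * F).trace) = β * F.trace := by
    rw [← Matrix.trace_add, ← Matrix.add_mul, ← smul_eq_mul, ← Matrix.trace_smul,
      ← Matrix.mul_smul, ← f1, ← Matrix.mul_assoc, h6]; simp
  have k56 : (A' * M * A'ᴴ * F').trace = q * (A'ᴴ * A' * F).trace := by
    rw [Matrix.trace_mul_comm, ← Matrix.mul_assoc, ← Matrix.mul_assoc, iA', Matrix.mul_assoc A', f2,
      Matrix.trace_mul_comm, Matrix.mul_smul, Matrix.mul_smul, Matrix.trace_smul, smul_eq_mul,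
      Matrix.mul_assoc]
  -- The relations with `α` identify the `C'` term with the `C` term; those with `β` identify them
  -- up to the factor `q`. As `q ≠ 1`, both are zero.
  have kP : (C'ᴴ * C' * F).trace = (Cᴴ * C * F').trace := by
    linear_combination k4 - k14 - k1 + α * ta
  have k0 : (Cᴴ * C * F').trace = 0 := by
    have : (q - 1) * (Cᴴ * C * F').trace = 0 := by
      linear_combination k6 - k5 + k56 + β * ta - q * kP
    exact (mul_eq_zero.1 this).resolve_left (sub_ne_zero.2 hq)
  have ea' : a' = z • 1 := eq_smul_one_of_trace_mul_sqDist hC k0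
  have t0 : F'.trace = 0 := by rw [hF', ea', sqDist]; simp
  exact ⟨z, eq_smul_one_of_trace_sqDist (ta.trans t0), eq_smul_one_of_trace_sqDist (td.trans t0),
    ea', eq_smul_one_of_trace_sqDist (td'.symm.trans (td.trans t0))⟩

end MatrixLemmas

/-! ### Rank one structure of `ν(x) ν(x)†` -/

/-- Rows `j` and `k` are multiplied over the first `N` columns, by induction on `N`. With `E` the
new product of exponentials, the step is `(1 - q) q E + (1 - q)² E = (1 - q) E`, where `q = e^{-x}`.
-/
theorem sum_nu_mul_nu {n : ℕ} (x : ℝ) {j k : Fin n} (hjk : j ≤ k) :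
    (nu n x * (nu n x)ᴴ) j k = (if j = k then (Real.exp (-x) : ℂ) else 0) +
      (((1 - Real.exp (-x)) * (Real.exp (((n : ℝ) - 1 - j) * x / 2) *
        Real.exp (((n : ℝ) - 1 - k) * x / 2)) : ℝ) : ℂ) := by
  let r : ℕ → ℕ → ℝ := fun j l => if j = l then 1 else if j < l then
    (1 - Real.exp (-x)) * Real.exp (((l : ℝ) - (j : ℝ)) * x / 2) else 0
  have hr : ∀ a b : Fin n, nu n x a b = (r a b : ℂ) := by
    intro a b
    simp only [nu, r, Matrix.of_apply, Fin.ext_iff, Fin.lt_def]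
    split_ifs <;> simp
  -- The induction starts at `N = k + 1`: row `k` vanishes left of the diagonal, so column `k` gives
  -- the first nonzero term. On the diagonal this is `1 = q + (1 - q)`.
  have key : ∀ N : ℕ, (k : ℕ) + 1 ≤ N → ∑ l ∈ Finset.range N, r j l * r k l =
      (if j = k then Real.exp (-x) else 0) +
      ((1 - Real.exp (-x)) * (Real.exp (((N : ℝ) - 1 - j) * x / 2) *
        Real.exp (((N : ℝ) - 1 - k) * x / 2))) := by
    intro N hN
    induction N, hN using Nat.le_induction with
    | base =>
      rw [Finset.sum_range_succ, Finset.sum_eq_zero, zero_add]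
      · rcases hjk.eq_or_lt with rfl | h
        · simp [r]
        · have h' : (j : ℕ) < k := h
          simp [r, h.ne, h', h'.ne]
      · intro l hl
        have h' : l < (k : ℕ) := Finset.mem_range.1 hl
        simp [r, h'.ne', h'.not_gt]
    | succ N hN ih =>
      have h1 : (k : ℕ) < N := hN
      have h2 : (j : ℕ) < N := lt_of_le_of_lt hjk h1
      rw [Finset.sum_range_succ, ih]
      simp only [r, h1, h2, h1.ne, h2.ne, if_true, if_false]
      rw [← Real.exp_add, mul_mul_mul_comm, ← Real.exp_add, add_assoc, add_right_inj]
      push_cast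
      rw [← Real.exp_add]
      have e1 : Real.exp (((N : ℝ) - 1 - j) * x / 2 + ((N : ℝ) - 1 - k) * x / 2) =
          Real.exp (-x) * Real.exp (((N : ℝ) - j) * x / 2 + ((N : ℝ) - k) * x / 2) := by
        rw [← Real.exp_add]; ring_nf
      have e2 : ((N : ℝ) + 1 - 1 - j) * x / 2 + ((N : ℝ) + 1 - 1 - k) * x / 2 =
        ((N : ℝ) - j) * x / 2 + ((N : ℝ) - k) * x / 2 := by ring
      rw [e1, e2]; ring
  rw [Matrix.mul_apply]
  simp only [Matrix.conjTranspose_apply, hr, Complex.star_def, Complex.conj_ofReal]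
  rw [Fin.sum_univ_eq_sum_range (fun l => (r j l : ℂ) * (r k l : ℂ)) n]
  have := key n k.2
  have h := congrArg (fun t : ℝ => (t : ℂ)) this
  simp only [Complex.ofReal_sum, Complex.ofReal_mul] at h
  rw [h, Complex.ofReal_add]
  split_ifs <;> simp

/-- The vector spanning the range of the rank one part of `ν(x) ν(x)†`. -/
noncomputable def nuVec (n : ℕ) (x : ℝ) : Fin n → ℂ := fun j =>
  (Real.exp (((n : ℝ) - 1 - j) * x / 2) : ℂ)

theorem nu_mul_conjTranspose (n : ℕ) (x : ℝ) :
    nu n x * (nu n x)ᴴ = (Real.exp (-x) : ℂ) • 1 +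
      ((1 - Real.exp (-x) : ℝ) : ℂ) • Matrix.vecMulVec (nuVec n x) (star (nuVec n x)) := by
  have hs : star (nuVec n x) = nuVec n x := by
    ext j; exact Complex.conj_ofReal _
  have h1 : ∀ j k : Fin n, j ≤ k → (nu n x * (nu n x)ᴴ) j k = ((Real.exp (-x) : ℂ) • 1 +
      ((1 - Real.exp (-x) : ℝ) : ℂ) • Matrix.vecMulVec (nuVec n x) (star (nuVec n x))) j k := by
    intro j k hjk
    rw [sum_nu_mul_nu x hjk, hs]
    simp only [Matrix.add_apply, Matrix.smul_apply, Matrix.one_apply, Matrix.vecMulVec_apply, nuVec,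
      smul_eq_mul, mul_ite, mul_one, mul_zero, Complex.ofReal_mul]
  ext j k
  rcases le_total j k with h | h
  · exact h1 j k h
  -- Both sides are Hermitian, so the entries below the diagonal follow from those above.
  · have e := congrArg star (h1 k j h)
    have hH : (nu n x * (nu n x)ᴴ)ᴴ = nu n x * (nu n x)ᴴ := by simp
    rw [← Matrix.conjTranspose_apply, ← Matrix.conjTranspose_apply, hH] at e
    rw [e, Matrix.conjTranspose_add, Matrix.conjTranspose_smul, Matrix.conjTranspose_smul,
      Matrix.conjTranspose_one, Matrix.conjTranspose_vecMulVec, star_star, Complex.star_def,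
      Complex.conj_ofReal, Complex.conj_ofReal]

/-! ### Block relations from the Iwasawa decompositions -/

/-- Norm relations between the blocks of `K = b g†` and of its inverse `L`, for unitary `g` and block
upper triangular `b` with diagonal blocks `s ν` and `t 1`. -/
theorem iwasawa_block_relations {m : Type*} [Fintype m] [DecidableEq m]
    {K L g b : Matrix (m ⊕ m) (m ⊕ m) ℂ} {ν : Matrix m m ℂ} {s t : ℝ} (hst : s * t = 1)
    (hν : IsUnit ν.det) (hg : g * gᴴ = 1) (hK : K = b * gᴴ) (hL : g = L * b)
    (h11 : b.toBlocks₁₁ = (s : ℂ) • ν) (h21 : b.toBlocks₂₁ = 0)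
    (h22 : b.toBlocks₂₂ = (t : ℂ) • 1) :
    L.toBlocks₁₁ * (ν * νᴴ) * (L.toBlocks₁₁)ᴴ + (K.toBlocks₂₁)ᴴ * K.toBlocks₂₁ =
        ((t ^ 2 : ℝ) : ℂ) • 1 ∧
      K.toBlocks₂₁ * (K.toBlocks₂₁)ᴴ + K.toBlocks₂₂ * (K.toBlocks₂₂)ᴴ = ((t ^ 2 : ℝ) : ℂ) • 1 ∧
      ((L.toBlocks₁₁)ᴴ * L.toBlocks₁₁ + (L.toBlocks₂₁)ᴴ * L.toBlocks₂₁) * (ν * νᴴ) =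
        ((t ^ 2 : ℝ) : ℂ) • 1 := by
  have hg' : gᴴ * g = 1 := mul_eq_one_comm.1 hg
  have hstC : (s : ℂ) * t = 1 := by exact_mod_cast hst
  obtain ⟨A, B, C, D, rfl⟩ : ∃ A B C D, K = Matrix.fromBlocks A B C D :=
    ⟨_, _, _, _, (Matrix.fromBlocks_toBlocks K).symm⟩
  obtain ⟨A', B', C', D', rfl⟩ : ∃ A B C D, L = Matrix.fromBlocks A B C D :=
    ⟨_, _, _, _, (Matrix.fromBlocks_toBlocks L).symm⟩
  obtain ⟨g₁, g₂, g₃, g₄, rfl⟩ : ∃ A B C D, g = Matrix.fromBlocks A B C D :=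
    ⟨_, _, _, _, (Matrix.fromBlocks_toBlocks g).symm⟩
  obtain ⟨b₁, b₂, b₃, b₄, rfl⟩ : ∃ A B C D, b = Matrix.fromBlocks A B C D :=
    ⟨_, _, _, _, (Matrix.fromBlocks_toBlocks b).symm⟩
  simp only [Matrix.toBlocks_fromBlocks₁₁, Matrix.toBlocks_fromBlocks₂₁,
    Matrix.toBlocks_fromBlocks₂₂] at h11 h21 h22 ⊢
  subst h11 h21 h22
  rw [Matrix.fromBlocks_conjTranspose, Matrix.fromBlocks_multiply, ← Matrix.fromBlocks_one,
    Matrix.fromBlocks_inj] at hg hg'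
  rw [Matrix.fromBlocks_conjTranspose, Matrix.fromBlocks_multiply, Matrix.fromBlocks_inj] at hK
  rw [Matrix.fromBlocks_multiply, Matrix.fromBlocks_inj] at hL
  obtain ⟨-, -, hC, hD⟩ := hK
  obtain ⟨hA', -, hC', -⟩ := hL
  simp only [Matrix.zero_mul, zero_add, Matrix.smul_mul, Matrix.one_mul, Matrix.mul_zero, add_zero,
    Matrix.mul_smul] at hC hD hA' hC'
  have ht2 : ((t ^ 2 : ℝ) : ℂ) = t * t := by push_cast; ring
  -- As `s⁻¹ = t`, the first block column of `g = L b` gives that of `L ν` as `t` times that of `g`.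
  -- The bottom row of `K` is likewise `t` times that of `g†`, so unitarity of `g` yields all three
  -- relations.
  have hA'' : (t : ℂ) • g₁ = A' * ν := by
    rw [hA', smul_smul, mul_comm, hstC, one_smul]
  have hC'' : (t : ℂ) • g₃ = C' * ν := by
    rw [hC', smul_smul, mul_comm, hstC, one_smul]
  have hcol : νᴴ * (A'ᴴ * A' + C'ᴴ * C') * ν = (t * t : ℂ) • 1 := by
    calc νᴴ * (A'ᴴ * A' + C'ᴴ * C') * ν
        = (A' * ν)ᴴ * (A' * ν) + (C' * ν)ᴴ * (C' * ν) := by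
          simp only [Matrix.conjTranspose_mul, Matrix.mul_add, Matrix.add_mul, Matrix.mul_assoc]
      _ = (t * t : ℂ) • (g₁ᴴ * g₁ + g₃ᴴ * g₃) := by
          rw [← hA'', ← hC'']
          simp only [Matrix.conjTranspose_smul, Matrix.smul_mul, Matrix.mul_smul, smul_smul,
            smul_add, Complex.star_def, Complex.conj_ofReal]
      _ = _ := by rw [hg'.1]
  refine ⟨?_, ?_, ?_⟩
  · calc A' * (ν * νᴴ) * A'ᴴ + Cᴴ * C = (A' * ν) * (A' * ν)ᴴ + Cᴴ * C := by
          simp only [Matrix.conjTranspose_mul, Matrix.mul_assoc]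
      _ = (t * t : ℂ) • (g₁ * g₁ᴴ + g₂ * g₂ᴴ) := by
          rw [← hA'', hC]
          simp only [Matrix.conjTranspose_smul, Matrix.smul_mul, Matrix.mul_smul, smul_smul,
            smul_add, Complex.star_def, Complex.conj_ofReal, Matrix.conjTranspose_conjTranspose]
      _ = _ := by rw [hg.1, ht2]
  · rw [hC, hD, ht2, ← hg'.2.2.2]
    simp only [Matrix.conjTranspose_smul, Matrix.smul_mul, Matrix.mul_smul, smul_smul,
      smul_add, Complex.star_def, Complex.conj_ofReal, Matrix.conjTranspose_conjTranspose]
  -- The column relation reads `ν† X ν = t²`; conjugating by `ν†` turns it into `X ν ν† = t²`.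
  · have hνH : IsUnit νᴴ.det := by rw [Matrix.det_conjTranspose]; exact hν.star
    rw [ht2, ← Matrix.nonsing_inv_mul_cancel_left νᴴ
      ((A'ᴴ * A' + C'ᴴ * C') * (ν * νᴴ)) hνH, ← Matrix.mul_assoc νᴴ, ← Matrix.mul_assoc _ ν,
      hcol, Matrix.smul_mul, Matrix.one_mul, Matrix.mul_smul,
      Matrix.nonsing_inv_mul _ hνH]

theorem SU.coe_inv {n : ℕ} {g : SL n} (hg : g ∈ SU n) : (g⁻¹).1 = (g.1)ᴴ := by
  rw [← Matrix.one_mul (g⁻¹).1, ← mul_eq_one_comm.1 (SU.mem_iff.1 hg), Matrix.mul_assoc,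
    coe_mul_coe_inv, Matrix.mul_one]

theorem toBlocks_of_proj_eq {n : ℕ} {b : SB n} {t : ℝ} {a : Matrix (Fin n) (Fin n) ℂ}
    (ha : IsPosTriangular (id : Fin n → Fin n) a) (hdet : a.det = 1)
    (h : proj b = blockDiagDual t a ha hdet) :
    b.1.1.toBlocks₁₁ = (Real.exp t : ℂ) • a ∧ b.1.1.toBlocks₂₁ = 0 ∧
      b.1.1.toBlocks₂₂ = (Real.exp (-t) : ℂ) • 1 := by
  have h1 : Matrix.fromBlocks b.1.1.toBlocks₁₁ 0 0 b.1.1.toBlocks₂₂ =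
      Matrix.fromBlocks ((Real.exp t : ℂ) • a) 0 0 ((Real.exp (-t) : ℂ) • 1) :=
    congrArg (fun β : GplusDual n => β.1.1) h
  obtain ⟨e1, -, -, e2⟩ := Matrix.fromBlocks_inj.1 h1
  exact ⟨e1, SB.toBlocks₂₁ b.2, e2⟩

theorem Gplus.exists_blocks {n : ℕ} (η : Gplus n) : ∃ a d : Matrix (Fin n) (Fin n) ℂ,
    η.1.1 = Matrix.fromBlocks a 0 0 d ∧ aᴴ * a = 1 ∧ dᴴ * d = 1 ∧ (η⁻¹).1.1.toBlocks₁₁ = aᴴ := by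
  have e : η.1.1 = Matrix.fromBlocks η.1.1.toBlocks₁₁ 0 0 η.1.1.toBlocks₂₂ := by
    conv_lhs => rw [← Matrix.fromBlocks_toBlocks η.1.1, η.2.2.1, η.2.2.2]
  have hu : (η.1.1)ᴴ * η.1.1 = 1 := mul_eq_one_comm.1 (SU.mem_iff.1 η.2.1)
  have hi : (η⁻¹).1.1 = (η.1.1)ᴴ := SU.coe_inv η.2.1
  rw [e, Matrix.fromBlocks_conjTranspose, Matrix.fromBlocks_multiply, ← Matrix.fromBlocks_one,
    Matrix.fromBlocks_inj] at hu
  obtain ⟨h1, -, -, h2⟩ := hu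
  exact ⟨_, _, e, by simpa using h1, by simpa using h2, by rw [hi]; rfl⟩

/-! ### Stabilizers on the constraint surface -/

/-- A gauge transformation fixing a point of the constraint surface is central. -/
theorem mem_centralSubgroup_of_fixed {n : ℕ} (hn : 0 < n) {u v x : ℝ} (huv : u < v) (hvu : v ≠ -u)
    (hx : x ≠ 0) {ηL ηR : Gplus n} (hηL : ηL ∈ isotropyGroup (muL n u x)) {K : SL n}
    (hK : PhiPlus K = mu n u v x) (hfix : (ηL : SL n) * K = K * (ηR : SL n)) :
    (ηL, ηR) ∈ centralSubgroup n := by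
  have hfix' : K⁻¹ * (ηL : SL n) = (ηR : SL n) * K⁻¹ := by
    rw [inv_mul_eq_iff_eq_mul, ← mul_assoc, ← hfix, mul_assoc, mul_inv_cancel, mul_one]
  obtain ⟨gR, hgR⟩ := (bL_eq_iff K _).1 rfl
  obtain ⟨gL, hgL⟩ := (bR_eq_iff K _).1 rfl
  obtain ⟨l1, l2, l3⟩ := toBlocks_of_proj_eq (b := bL K)
    ⟨nu_blockTriangular n x, fun i => ⟨1, one_pos, by simp [nu]⟩⟩ (det_nu n x) (congrArg Prod.fst hK)
  obtain ⟨r1, r2, r3⟩ := toBlocks_of_proj_eq (b := bR K) (IsPosTriangular.one _) Matrix.det_one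
    (congrArg Prod.snd hK)
  have hexp : ∀ t : ℝ, Real.exp t * Real.exp (-t) = 1 := fun t => by rw [← Real.exp_add]; simp
  have hgL' : K⁻¹ = (bR K : SL n) * (gL : SL n)⁻¹ := by
    conv_lhs => rw [hgL]
    simp
  have hLb : (gR : SL n) = K⁻¹ * (bL K : SL n) := by
    rw [eq_inv_mul_iff_mul_eq]
    conv_lhs => enter [1]; rw [hgR]
    simp
  have hKb : (gL : SL n) = K * (bR K : SL n) := by
    conv_rhs => enter [1]; rw [hgL]
    simp
  obtain ⟨h5, h2, h6⟩ := iwasawa_block_relations (K := K.1) (L := (K⁻¹).1) (hexp u)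
    (by rw [det_nu]; exact isUnit_one) (SU.mem_iff.1 gR.2)
    (by rw [← SU.coe_inv gR.2]; exact congrArg Subtype.val hgR) (congrArg Subtype.val hLb) l1 l2 l3
  -- The right decomposition of `K` is a left decomposition `K⁻¹ = b_R g_L⁻¹`, so the same lemma
  -- applies with `K` and `K⁻¹` exchanged, `ν = 1` and `t = e^{-v}`.
  obtain ⟨h4, h3, h1⟩ := iwasawa_block_relations (K := (K⁻¹).1) (L := K.1) (hexp v)
    (by rw [Matrix.det_one]; exact isUnit_one) (SU.mem_iff.1 gL.2)
    (by rw [← SU.coe_inv gL.2]; exact congrArg Subtype.val hgL') (congrArg Subtype.val hKb) r1 r2 r3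
  rw [mem_isotropyGroup_muL_iff] at hηL
  obtain ⟨a, d, hη, ha, hd, hai⟩ := Gplus.exists_blocks ηL
  obtain ⟨a', d', hη', ha', hd', -⟩ := Gplus.exists_blocks ηR
  have hKL : K.1 * (K⁻¹).1 = 1 := coe_mul_coe_inv K
  have hdetK : K.1.det = 1 := K.2
  have hfixM : ηL.1.1 * K.1 = K.1 * ηR.1.1 := congrArg Subtype.val hfix
  have hfixM' : (K⁻¹).1 * ηL.1.1 = ηR.1.1 * (K⁻¹).1 := congrArg Subtype.val hfix'
  obtain ⟨A, B, C, D, eK⟩ : ∃ A B C D, K.1 = Matrix.fromBlocks A B C D :=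
    ⟨_, _, _, _, (Matrix.fromBlocks_toBlocks K.1).symm⟩
  obtain ⟨A', B', C', D', eL⟩ : ∃ A B C D, (K⁻¹).1 = Matrix.fromBlocks A B C D :=
    ⟨_, _, _, _, (Matrix.fromBlocks_toBlocks (K⁻¹).1).symm⟩
  rw [hη, hai, Matrix.toBlocks_fromBlocks₁₁] at hηL
  rw [hη, hη', eK] at hfixM
  rw [hη, hη', eL] at hfixM'
  rw [eK] at h1 h2 h4 h5 hKL hdetK
  rw [eL] at h3 h4 h5 h6 hKL
  simp only [Matrix.toBlocks_fromBlocks₁₁, Matrix.toBlocks_fromBlocks₂₁,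
    Matrix.toBlocks_fromBlocks₂₂, Matrix.conjTranspose_one, Matrix.mul_one] at h1 h2 h3 h4 h5 h6
  simp only [Matrix.fromBlocks_multiply, Matrix.fromBlocks_inj, Matrix.zero_mul, Matrix.mul_zero,
    add_zero, zero_add] at hfixM hfixM'
  rw [Matrix.fromBlocks_multiply, ← Matrix.fromBlocks_one, Matrix.fromBlocks_inj] at hKL
  have hKL12 : A'ᴴ * Cᴴ + C'ᴴ * Dᴴ = 0 := by
    rw [← Matrix.conjTranspose_mul, ← Matrix.conjTranspose_mul, ← Matrix.conjTranspose_add,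
      hKL.2.2.1, Matrix.conjTranspose_zero]
  have hC : IsUnit C.det := by
    refine isUnit_det_lowerLeft ?_ h2 h3 hKL.2.2.2 hKL12
    -- The product of the two constants is `e^{-2(u+v)}`, which is `1` only if `v = -u`.
    rw [← Complex.ofReal_mul, ← mul_pow, ← Real.exp_add, ← Real.exp_nat_mul]
    intro h
    have h0 : Real.exp (((2 : ℕ) : ℝ) * (-u + -v)) = 1 := by exact_mod_cast h
    rw [Real.exp_eq_one_iff] at h0
    push_cast at h0
    exact hvu (by linarith)
  have hD : IsUnit D.det := by
    refine isUnit_det_lowerRight ?_ (pow_pos (Real.exp_pos (-u)) 2) h1 h2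
    exact pow_lt_pow_left₀ (Real.exp_lt_exp.2 (neg_lt_neg huv)) (Real.exp_pos _).le two_ne_zero
  have hq1 : Real.exp (-x) ≠ 1 := by simpa [Real.exp_eq_one_iff] using hx
  -- Unitarity of `a` turns invariance of `ν ν†` under conjugation into commutation.
  have haM : a * (nu n x * (nu n x)ᴴ) = nu n x * (nu n x)ᴴ * a := by
    calc a * (nu n x * (nu n x)ᴴ) = a * (nu n x * (nu n x)ᴴ) * (aᴴ * a) := by
          rw [ha, Matrix.mul_one]
      _ = _ := by rw [← Matrix.mul_assoc, hηL]
  have hw : nuVec n x ≠ 0 := by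
    intro h
    have h0 := congrFun h ⟨0, hn⟩
    simp only [nuVec, Pi.zero_apply, Complex.ofReal_eq_zero] at h0
    exact Real.exp_ne_zero _ h0
  obtain ⟨z, rfl, rfl, rfl, rfl⟩ := blocks_eq_smul_one (by exact_mod_cast hq1)
    (by exact_mod_cast sub_ne_zero.2 hq1.symm) hw (nu_mul_conjTranspose n x) haM hC hD
    (by rw [hdetK]; exact isUnit_one) h1 h4 h5 h6 ha hd (mul_eq_one_comm.1 ha')
    (mul_eq_one_comm.1 hd') hfixM.1 hfixM.2.2.1 hfixM.2.2.2 hfixM.2.1 hfixM'.1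
  refine ⟨Subtype.ext (Subtype.ext (hη.trans hη'.symm)), z, ?_, hη⟩
  have hdet : ηL.1.1.det = 1 := ηL.1.2
  rw [hη, Matrix.det_fromBlocks_zero₂₁, Matrix.det_smul, Matrix.det_one, Fintype.card_fin, mul_one,
    ← pow_add, ← two_mul] at hdet
  exact hdet

end HeisenbergDouble

open HeisenbergDouble in
theorem proposition4p3 (n : ℕ) (hn : 2 ≤ n) (u v x : ℝ)
    (huv : u < v) (hvu : v ≠ -u) (hx : x ≠ 0) :
    ∀ (g : EffectiveGaugeGroup (mu n u v x)) (K : ConstraintSurface (mu n u v x)),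
      g • K = K → g = 1 := by
  intro g K hgK
  obtain ⟨g, rfl⟩ := QuotientGroup.mk_surjective g
  rw [mk_smul] at hgK
  have h := congrArg Subtype.val hgK
  rw [coe_smul, mul_inv_eq_iff_eq_mul] at h
  exact (QuotientGroup.eq_one_iff g).2
    (mem_centralSubgroup_of_fixed (by omega) huv hvu hx g.2.1 K.2 h)
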